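/- **Setting.** Let $G=(V,E,w)$ be a finite connected undirected (simple) graph with non-negative real edge weights, $n=|V|$. An agent starts at a vertex $s$ (which is then explored), must visit all vertices and return to $s$; a vertex is *explored* once visited. A *boundary edge* is an edge $(u,v)$ with $u$ explored and $v$ unexplored. A path is *internally explored* if all its internal vertices are explored, and $d(x,y)$ is the length of a shortest internally explored $x$–$y$ path at the current time. For $\delta>0$, a boundary edge $e=(u,v)$ is *$\delta$-blocked* by another boundary edge $e'=(u',v')$ if $w(e')<w(e)$ and $d(u,v')\le(1+\delta)\,w(e)$; it is $\delta$-blocked if some boundary edge blocks it. The algorithm $\mathrm{Blocking}_\delta(v)$, first called with $v=s$, is: *while there is a boundary edge $e=(y,x)$ that is not $\delta$-blocked and such that $y=v$ or $e$ was at some earlier time $\delta$-blocked by some edge $(u,v)$: walk along a shortest internally explored path from $v$ to $y$; traverse $e$; execute $\mathrm{Blocking}_\delta(x)$; walk along a shortest internally explored path from $x$ to $v$.* The cost is the total weight of all edge traversals; where several edges satisfy the loop condition the algorithm does not specify which one is taken, and this choice is made adversarially. Let $\mathrm{Opt}(G)$ be the minimum length of a closed walk in $G$ that visits all vertices. For given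 $n$ and $\delta$, let the competitive ratio $\rho(n,\delta)\in[0,\infty]$ be the infimum of all $\rho$ such that for every such graph $G$ with exactly $n$ vertices, every start vertex and every execution, the cost of $\mathrm{Blocking}_\delta$ is at most $\rho\cdot\mathrm{Opt}(G)$. **Theorem 3.** Let $\delta=\delta(n)>0$ be any function of the number $n$ of vertices. As $n\to\infty$, the competitive ratio $\rho(n,\delta(n))$ of $\mathrm{Blocking}_{\delta}$ is a) in $\Omega(\log n/\log\log n)$; b) in $\Omega(\log n)$ if $\delta\in o(\log n/\log\log n)$, and also in $\Omega(\log n)$ if $\delta\in\Omega(\log n)$. Here $\rho(n,\delta(n))\in\Omega(f(n))$ means that there is $c>0$ with $\rho(n,\delta(n))\ge c\,f(n)$ for all sufficiently large $n$. -/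

import Mathlib

open Filter Asymptotics
open scoped ENNReal NNReal

/-! A weighted graph is a `SimpleGraph` together with non-negative weights `w : Sym2 V → ℝ≥0`
(only the values on edges matter).  The exploration history is the list `h` of the vertices
explored so far, most recently explored vertex first; the explored set is `{z | z ∈ h}`, and the
earlier stages of the exploration are the suffixes of `h`. -/

namespace OnlineExploration

variable {V : Type*} (G : SimpleGraph V) (w : Sym2 V → ℝ≥0)

/-- The length of a walk: the sum of the weights of its edges, with multiplicity. -/
def walkWeight {x y : V} (p : G.Walk x y) : ℝ≥0 := (p.edges.map w).sum

/-- The offline optimum: the length of a shortest closed walk that visits all vertices. -/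
noncomputable def opt : ℝ≥0∞ :=
  ⨅ (r : V) (p : G.Walk r r) (_ : ∀ z : V, z ∈ p.support), (walkWeight G w p : ℝ≥0∞)

/-- `(y, x)` is a boundary edge: `y` is explored and `x` is unexplored. -/
def Boundary (h : List V) (y x : V) : Prop := G.Adj y x ∧ y ∈ h ∧ x ∉ h

/-- `p` is a path all of whose internal vertices are explored. -/
def InternallyExplored (h : List V) {x y : V} (p : G.Walk x y) : Prop :=
  p.IsPath ∧ ∀ z ∈ p.support, z ≠ x → z ≠ y → z ∈ h

/-- The length of a shortest internally explored path from `x` to `y` (`⊤` if there is none). -/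
noncomputable def exploredDist (h : List V) (x y : V) : ℝ≥0∞ :=
  ⨅ (p : G.Walk x y) (_ : InternallyExplored G h p), (walkWeight G w p : ℝ≥0∞)

/-- The boundary edge `(y, x)` is `δ`-blocked by the boundary edge `(u', v')`. -/
def BlockedBy (δ : ℝ) (h : List V) (y x u' v' : V) : Prop :=
  Boundary G h y x ∧ Boundary G h u' v' ∧ w s(u', v') < w s(y, x) ∧
    exploredDist G w h y v' ≤ ENNReal.ofReal ((1 + δ) * (w s(y, x) : ℝ))

/-- The condition of the while loop of `Blocking_δ(v)`: `(y, x)` is a boundary edge that is not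
`δ`-blocked now, and either `y = v` or `(y, x)` was `δ`-blocked at some earlier stage by an edge
`(u, v)`. -/
def Candidate (δ : ℝ) (h : List V) (v y x : V) : Prop :=
  Boundary G h y x ∧ (¬ ∃ u' v', BlockedBy G w δ h y x u' v') ∧
    (y = v ∨ ∃ h', h' <:+ h ∧ ∃ u, BlockedBy G w δ h' y x u v)

/-- `BlockingExec G w δ v h h' c`: the call `Blocking_δ(v)`, started when the exploration history
is `h`, can terminate with history `h'` and cost `c`.  Each constructor is one evaluation of
the loop condition; in an iteration the agent walks from `v` to `y`, traverses `(y, x)`, executes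
the recursive call `Blocking_δ(x)` and walks back from `x` to `v`.  The choice among several
admissible edges is left open, as it is in the algorithm. -/
inductive BlockingExec (δ : ℝ) : V → List V → List V → ℝ≥0∞ → Prop
  | done (v : V) (h : List V) (hv : ¬ ∃ y x, Candidate G w δ h v y x) :
      BlockingExec δ v h h 0
  | step (v y x : V) (h h₁ h₂ : List V) (c₁ c₂ : ℝ≥0∞)
      (hc : Candidate G w δ h v y x)
      (hrec : BlockingExec δ x (x :: h) h₁ c₁)
      (hloop : BlockingExec δ v h₁ h₂ c₂) :
      BlockingExec δ v h h₂
        (exploredDist G w h v y + (w s(y, x) : ℝ≥0∞) + c₁ + exploredDist G w h₁ x v + c₂)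

/-- `Blocking_δ` is (strictly) `ρ`-competitive on the connected weighted graphs with `n` vertices:
on every such graph and from every start vertex, every execution costs at most `ρ` times the
offline optimum. -/
def IsCompetitive (n : ℕ) (δ : ℝ) (ρ : ℝ≥0∞) : Prop :=
  ∀ (G : SimpleGraph (Fin n)) (w : Sym2 (Fin n) → ℝ≥0), G.Connected →
    ∀ (s : Fin n) (h : List (Fin n)) (c : ℝ≥0∞),
      BlockingExec G w δ s [s] h c → c ≤ ρ * opt G w

/-- The (strict) competitive ratio of `Blocking_δ` on the connected weighted graphs with
`n` vertices. -/
noncomputable def competitiveRatio (n : ℕ) (δ : ℝ) : ℝ≥0∞ := sInf {ρ | IsCompetitive n δ ρ}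

/-- `R ∈ Ω(f)`, for a function `R` with values in `[0, ∞]`. -/
def IsOmega (R : ℕ → ℝ≥0∞) (f : ℕ → ℝ) : Prop :=
  ∃ c : ℝ, 0 < c ∧ ∀ᶠ n in atTop, ENNReal.ofReal (c * f n) ≤ R n

end OnlineExploration

/-! Two families of instances give the bounds, and the adversary only has to exhibit one expensive
execution on each.

Large `δ`: a broom, a path of total weight `m ≤ δ` with `m` unit leaves at its first vertex. All
leaf edges are blocked by the last path edge, so they are postponed to the call at the far end of
the path. Each leaf then requires a walk along the whole path. The cost is at least `m²` while a
tour of length `4m` exists (`competitiveRatio_ge_of_le`).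

Small `δ`: a hub graph. Its cheap edges contain a spanning tree of weight `O(N(δ+1))`: a spine
carrying `N` cluster centers, `d` two-edge branches center–link–port per cluster, and `2N` arms of
length `δ/2` at a hub. Each port is also joined to the end of an arm by a heavy edge of weight about
`1`. Heavy edges are blocked by the tip, which is explored last, so the call at its end (the apex)
may take all of them. If every port is reached by its heavy edge, the cost is at least `N d`, and
the ratio is of order `d/(δ+1)` (`competitiveRatio_ge_of_cluster_size`).

For this, no heavy edge of the current cluster may be blocked by a cheap edge at an unexplored link.
Weights increase from cluster to cluster, so clusters are finished one after the other. The
remaining danger is a shortcut from one arm to another through finished clusters. Clusters are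
viewed as hyperedges on the set of arms. The hypergraph is built greedily so that two arms of a
cluster are at distance more than `g`, about `δ/2`, through earlier hyperedges, each of which costs
about `2` to cross (`exists_sparse_hypergraph`, `PortPhase.not_blocked`). This needs `N` about `d ^
O(δ)`. With `d` about `log² n` it fits into `n` vertices as long as `δ` is at most a small multiple
of `log n / log log n`, and yields ratio `Ω(log n)`. Beyond that threshold the brooms give the first
bound, and for `δ ∈ Ω(log n)` they give `Ω(log n)`. -/

namespace OnlineExploration

/-! ### Explored distances, executions and tours in arbitrary graphs. -/

section General

variable {V : Type*} {G : SimpleGraph V} {w : Sym2 V → ℝ≥0} {δ : ℝ}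

@[simp] lemma walkWeight_nil (x : V) : walkWeight G w (SimpleGraph.Walk.nil : G.Walk x x) = 0 := by
  simp [walkWeight]

@[simp] lemma walkWeight_cons {x y z : V} (a : G.Adj x y) (p : G.Walk y z) :
    walkWeight G w (SimpleGraph.Walk.cons a p) = w s(x, y) + walkWeight G w p := by
  simp [walkWeight]

lemma walkWeight_append {x y z : V} (p : G.Walk x y) (q : G.Walk y z) :
    walkWeight G w (p.append q) = walkWeight G w p + walkWeight G w q := by
  simp [walkWeight, SimpleGraph.Walk.edges_append]

lemma walkWeight_reverse {x y : V} (p : G.Walk x y) :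
    walkWeight G w p.reverse = walkWeight G w p := by
  simp [walkWeight, List.sum_reverse]

lemma walkWeight_bypass_le [DecidableEq V] {x y : V} (p : G.Walk x y) :
    walkWeight G w p.bypass ≤ walkWeight G w p :=
  (p.edges_bypass_sublist_edges.map w).sum_le_sum (fun _ _ => zero_le)

/-- Any walk through explored vertices bounds the explored distance of its ends from above. -/
lemma exploredDist_le_walkWeight {h : List V} {x y : V} (p : G.Walk x y)
    (hp : ∀ z ∈ p.support, z ≠ y → z ∈ h) : exploredDist G w h x y ≤ walkWeight G w p := by
  classical
  refine (iInf₂_le p.bypass ⟨p.bypass_isPath, fun z hz _ hy =>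
    hp z (p.support_bypass_subset_support hz) hy⟩).trans ?_
  exact_mod_cast walkWeight_bypass_le p

lemma sub_le_walkWeight (φ : V → ℝ) (S : Set V)
    (hφ : ∀ a b, G.Adj a b → a ∈ S → b ∈ S → φ b - φ a ≤ w s(a, b)) {x y : V} (p : G.Walk x y)
    (hp : ∀ z ∈ p.support, z ∈ S) : φ y - φ x ≤ walkWeight G w p := by
  induction p with
  | nil => simp
  | cons a p ih =>
    rw [walkWeight_cons]
    push_cast
    have h1 := ih (fun z hz => hp z (by simp [hz]))
    have h2 := hφ _ _ a (hp _ (by simp)) (hp _ (by simp))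
    linarith

/-- A potential that is 1-Lipschitz on the explored vertices and the target bounds the explored
distance from below. -/
lemma le_exploredDist (φ : V → ℝ) {h : List V} {x y : V} (hx : x ∈ h)
    (hφ : ∀ a b, G.Adj a b → (a ∈ h ∨ a = y) → (b ∈ h ∨ b = y) → φ b - φ a ≤ w s(a, b)) :
    ENNReal.ofReal (φ y - φ x) ≤ exploredDist G w h x y := by
  refine le_iInf₂ fun p hp => ?_
  have := sub_le_walkWeight (w := w) φ {z | z ∈ h ∨ z = y} hφ p (fun z hz => by
    by_cases h1 : z = x
    · exact Or.inl (h1 ▸ hx)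
    · by_cases h2 : z = y
      · exact Or.inr h2
      · exact Or.inl (hp.2 z hz h1 h2))
  rw [← ENNReal.ofReal_coe_nnreal]
  exact ENNReal.ofReal_le_ofReal this

/-- Weak duality: a Lipschitz potential certifies that the head of a would-be blocking edge is too
far away. `h0` is needed because `ENNReal.ofReal` truncates negative numbers. -/
lemma not_blockedBy_of_potential (φ : V → ℝ) {h : List V} {y x u' v' : V}
    (hφ : ∀ a b, G.Adj a b → (a ∈ h ∨ a = v') → (b ∈ h ∨ b = v') → φ b - φ a ≤ w s(a, b))
    (hlt : (1 + δ) * (w s(y, x) : ℝ) < φ v' - φ y) (h0 : 0 < φ v' - φ y) :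
    ¬ BlockedBy G w δ h y x u' v' := by
  rintro ⟨hb, -, -, hd⟩
  have := (le_exploredDist φ hb.2.1 hφ).trans hd
  rw [← not_lt] at this
  exact this ((ENNReal.ofReal_lt_ofReal_iff h0).2 hlt)

lemma BlockingExec.suffix {v : V} {h h' : List V} {c : ℝ≥0∞}
    (e : BlockingExec G w δ v h h' c) : h <:+ h' := by
  induction e with
  | done => exact List.suffix_refl _
  | step v y x h h₁ h₂ c₁ c₂ hc _ _ ih1 ih2 =>
    exact ((List.suffix_cons x h).trans ih1).trans ih2

lemma BlockingExec.no_candidate {v : V} {h h' : List V} {c : ℝ≥0∞}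
    (e : BlockingExec G w δ v h h' c) : ¬ ∃ y x, Candidate G w δ h' v y x := by
  induction e with
  | done _ _ hv => exact hv
  | step _ _ _ _ _ _ _ _ _ _ _ _ ih2 => exact ih2

/-- The termination measure for all inductions over executions. -/
lemma card_unexplored_lt [Fintype V] [DecidableEq V] {h h' : List V} {x : V} (hx : x ∉ h)
    (hh : (x :: h) <:+ h') :
    (Finset.univ.filter (fun z => z ∉ h')).card < (Finset.univ.filter (fun z => z ∉ h)).card := by
  apply Finset.card_lt_card
  refine ⟨fun z => ?_, fun hs => ?_⟩
  · simp only [Finset.mem_filter, Finset.mem_univ, true_and]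
    exact fun h1 h2 => h1 (hh.subset (by simp [h2]))
  · have := hs (show x ∈ _ by simp [hx])
    simp only [Finset.mem_filter, Finset.mem_univ, true_and] at this
    exact this (hh.subset (by simp))

/-- Every call of `Blocking_δ` on a finite graph has a terminating execution. -/
lemma exists_blockingExec [Fintype V] (v : V) (h : List V) :
    ∃ h' c, BlockingExec G w δ v h h' c := by
  classical
  induction hn : (Finset.univ.filter (fun z => z ∉ h)).card using Nat.strong_induction_on
    generalizing v h with
  | _ n ih =>
    by_cases hv : ∃ y x, Candidate G w δ h v y x
    · obtain ⟨y, x, hc⟩ := hv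
      have hx := hc.1.2.2
      obtain ⟨h₁, c₁, e₁⟩ := ih _ (hn ▸ card_unexplored_lt hx (List.suffix_refl _)) x (x :: h) rfl
      obtain ⟨h₂, c₂, e₂⟩ := ih _ (hn ▸ card_unexplored_lt hx e₁.suffix) v h₁ rfl
      exact ⟨_, _, .step v y x h h₁ h₂ c₁ c₂ hc e₁ e₂⟩
    · exact ⟨_, _, .done v h hv⟩

/-- Some execution of `Blocking_δ(v)` from the history `h` costs at least `C`. -/
def CanCost (G : SimpleGraph V) (w : Sym2 V → ℝ≥0) (δ : ℝ) (v : V) (h : List V) (C : ℝ≥0∞) : Prop :=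
  ∃ h' c, BlockingExec G w δ v h h' c ∧ C ≤ c

/-- The adversary commits to one recursive call and counts only its cost. The rest of the loop is
completed arbitrarily. -/
lemma CanCost.of_call [Fintype V] {v y x : V} {h : List V} {C : ℝ≥0∞}
    (hc : Candidate G w δ h v y x) (hx : CanCost G w δ x (x :: h) C) : CanCost G w δ v h C := by
  obtain ⟨h₁, c₁, e₁, hC⟩ := hx
  obtain ⟨h₂, c₂, e₂⟩ := exists_blockingExec (G := G) (w := w) (δ := δ) v h₁
  refine ⟨_, _, .step v y x h h₁ h₂ c₁ c₂ hc e₁ e₂, hC.trans ?_⟩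
  exact (le_add_self.trans le_self_add).trans le_self_add

/-- The counterpart of `CanCost.of_call`: one iteration is played for free, and only the rest of the
loop is counted. -/
lemma CanCost.of_loop {v y x : V} {h h₁ : List V} {c₁ C : ℝ≥0∞}
    (hc : Candidate G w δ h v y x) (e₁ : BlockingExec G w δ x (x :: h) h₁ c₁)
    (hv : CanCost G w δ v h₁ C) : CanCost G w δ v h C := by
  obtain ⟨h₂, c₂, e₂, hC⟩ := hv
  exact ⟨_, _, .step v y x h h₁ h₂ c₁ c₂ hc e₁ e₂, hC.trans le_add_self⟩

lemma exists_closed_walk_insert {r a b : V} (p : G.Walk r r) (ha : a ∈ p.support)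
    (hab : G.Adj a b) : ∃ q : G.Walk r r, (∀ z, z ∈ p.support ∨ z = b → z ∈ q.support) ∧
      walkWeight G w q = walkWeight G w p + 2 * w s(a, b) := by
  classical
  refine ⟨(p.takeUntil a ha).append (.cons hab (.cons hab.symm (p.dropUntil a ha))), ?_, ?_⟩
  · rintro z (hz | rfl)
    · rw [← p.take_spec ha, SimpleGraph.Walk.mem_support_append_iff] at hz
      rw [SimpleGraph.Walk.mem_support_append_iff]
      rcases hz with hz | hz
      · exact Or.inl hz
      · right; simp [hz]
    · rw [SimpleGraph.Walk.mem_support_append_iff]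
      right; simp
  · conv_rhs => rw [← p.take_spec ha]
    rw [walkWeight_append, walkWeight_append, walkWeight_cons, walkWeight_cons, Sym2.eq_swap (a := b)]
    ring

/-- A rooted spanning tree, given by a parent function, is traversed by a closed walk that uses
each tree edge twice. -/
lemma exists_closed_walk_of_parent [Fintype V] (root : V) (par : V → V) (rank : V → ℕ)
    (pw : V → ℝ≥0) (hadj : ∀ x, x ≠ root → G.Adj (par x) x ∧ rank (par x) < rank x ∧
      w s(par x, x) ≤ pw x) :
    ∃ p : G.Walk root root, (∀ z, z ∈ p.support) ∧ walkWeight G w p ≤ 2 * ∑ x, pw x := by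
  classical
  -- Generalized to subtrees. A vertex of maximal rank is a leaf of the subtree, so it is added by a
  -- detour from its parent and back.
  suffices H : ∀ s : Finset V, (∀ x ∈ s, x ≠ root → par x ∈ s ∨ par x = root) →
      ∃ p : G.Walk root root, (∀ z ∈ s, z ∈ p.support) ∧ walkWeight G w p ≤ 2 * ∑ x ∈ s, pw x by
    obtain ⟨p, h1, h2⟩ := H Finset.univ (by simp)
    exact ⟨p, fun z => h1 z (by simp), h2⟩
  intro s
  induction s using Finset.induction_on_max_value rank with
  | empty => exact fun _ => ⟨.nil, by simp, by simp⟩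
  | insert a s ha hmax ih =>
    intro hs
    have hs' : ∀ x ∈ s, x ≠ root → par x ∈ s ∨ par x = root := by
      intro x hx hr
      rcases hs x (by simp [hx]) hr with h | h
      · rcases Finset.mem_insert.1 h with h | h
        · have h1 := (hadj x hr).2.1
          have h2 := hmax x hx
          rw [h] at h1
          omega
        · exact Or.inl h
      · exact Or.inr h
    obtain ⟨p, h1, h2⟩ := ih hs'
    rw [Finset.sum_insert ha]
    by_cases hr : a = root
    · refine ⟨p, ?_, h2.trans (by gcongr; exact le_add_self)⟩
      intro z hz
      rcases Finset.mem_insert.1 hz with rfl | hz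
      · subst hr; simp
      · exact h1 z hz
    · have hpar : par a ∈ p.support := by
        rcases hs a (by simp) hr with h | h
        · rcases Finset.mem_insert.1 h with h | h
          · have := (hadj a hr).2.1
            rw [h] at this
            omega
          · exact h1 _ h
        · rw [h]; simp
      obtain ⟨q, hq1, hq2⟩ := exists_closed_walk_insert (w := w) p hpar (hadj a hr).1
      refine ⟨q, ?_, ?_⟩
      · intro z hz
        rcases Finset.mem_insert.1 hz with rfl | hz
        · exact hq1 _ (Or.inr rfl)
        · exact hq1 _ (Or.inl (h1 z hz))
      · rw [hq2, mul_add, add_comm]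
        gcongr
        exact (hadj a hr).2.2

end General

/-! ### Invariance under isomorphism, to pass from structured vertex types to `Fin n`. -/

section Transfer

variable {V V' : Type*} {G : SimpleGraph V} {G' : SimpleGraph V'} {w : Sym2 V → ℝ≥0}
  {w' : Sym2 V' → ℝ≥0} {δ : ℝ}

lemma walkWeight_map (φ : G ≃g G') (hw : ∀ a b, w' s(φ a, φ b) = w s(a, b)) {x y : V}
    (p : G.Walk x y) : walkWeight G' w' (p.map φ.toHom) = walkWeight G w p := by
  induction p with
  | nil => simp
  | cons a p ih =>
    simp only [SimpleGraph.Walk.map_cons, walkWeight_cons, ih]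
    congr 1
    exact hw _ _

lemma exploredDist_map_le (φ : G ≃g G') (hw : ∀ a b, w' s(φ a, φ b) = w s(a, b)) (h : List V)
    (x y : V) : exploredDist G' w' (h.map φ) (φ x) (φ y) ≤ exploredDist G w h x y := by
  refine le_iInf₂ fun p hp => ?_
  have := walkWeight_map φ hw p
  rw [← this]
  refine iInf₂_le (p.map φ.toHom) ⟨?_, ?_⟩
  · exact hp.1.map φ.injective
  · intro z hz h1 h2
    rw [SimpleGraph.Walk.support_map, List.mem_map] at hz
    obtain ⟨z, hz, rfl⟩ := hz
    refine List.mem_map.2 ⟨z, hp.2 z hz ?_ ?_, rfl⟩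
    · rintro rfl; exact h1 rfl
    · rintro rfl; exact h2 rfl

lemma exploredDist_map (φ : G ≃g G') (hw : ∀ a b, w' s(φ a, φ b) = w s(a, b)) (h : List V)
    (x y : V) : exploredDist G' w' (h.map φ) (φ x) (φ y) = exploredDist G w h x y := by
  refine le_antisymm (exploredDist_map_le φ hw h x y) ?_
  have := exploredDist_map_le (w := w') (w' := w) φ.symm (fun a b => by
    have := hw (φ.symm a) (φ.symm b)
    simpa using this.symm) (h.map φ) (φ x) (φ y)
  simpa [List.map_map, Function.comp_def] using this

lemma boundary_map (φ : G ≃g G') (h : List V) (y x : V) :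
    Boundary G' (h.map φ) (φ y) (φ x) ↔ Boundary G h y x := by
  simp [Boundary, φ.map_adj_iff, List.mem_map, φ.injective.eq_iff]

lemma blockedBy_map (φ : G ≃g G') (hw : ∀ a b, w' s(φ a, φ b) = w s(a, b)) (h : List V)
    (y x u v : V) :
    BlockedBy G' w' δ (h.map φ) (φ y) (φ x) (φ u) (φ v) ↔ BlockedBy G w δ h y x u v := by
  simp only [BlockedBy, boundary_map, hw, exploredDist_map φ hw]

lemma candidate_map (φ : G ≃g G') (hw : ∀ a b, w' s(φ a, φ b) = w s(a, b)) (h : List V)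
    (v y x : V) :
    Candidate G' w' δ (h.map φ) (φ v) (φ y) (φ x) ↔ Candidate G w δ h v y x := by
  unfold Candidate
  rw [boundary_map, φ.injective.eq_iff]
  refine and_congr_right fun _ => and_congr (not_congr ?_) (or_congr_right ?_)
  · rw [φ.surjective.exists₂]
    simp only [blockedBy_map φ hw]
  · constructor
    · rintro ⟨h', hh, hb⟩
      -- Earlier stages are suffixes of the history, and every suffix of the image is the image of a
      -- suffix.
      obtain ⟨h'', hs, rfl⟩ : ∃ h'', h'' <:+ h ∧ h''.map φ = h' := by
        obtain ⟨t, ht⟩ := hh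
        obtain ⟨l₁, l₂, rfl, -, h2⟩ := List.map_eq_append_iff.1 ht.symm
        exact ⟨l₂, List.suffix_append _ _, h2⟩
      rw [φ.surjective.exists] at hb
      simp only [blockedBy_map φ hw] at hb
      exact ⟨h'', hs, hb⟩
    · rintro ⟨h', ⟨t, rfl⟩, u, hb⟩
      exact ⟨h'.map φ, ⟨t.map φ, by simp⟩, φ u, (blockedBy_map φ hw _ _ _ _ _).2 hb⟩

lemma BlockingExec.map (φ : G ≃g G') (hw : ∀ a b, w' s(φ a, φ b) = w s(a, b)) {v : V}
    {h h' : List V} {c : ℝ≥0∞} (e : BlockingExec G w δ v h h' c) :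
    BlockingExec G' w' δ (φ v) (h.map φ) (h'.map φ) c := by
  induction e with
  | done v h hv =>
    refine .done _ _ ?_
    rw [φ.surjective.exists₂]
    simpa only [candidate_map φ hw] using hv
  | step v y x h h₁ h₂ c₁ c₂ hc _ _ ih1 ih2 =>
    rw [← exploredDist_map φ hw h v y, ← exploredDist_map φ hw h₁ x v, ← hw y x]
    exact .step _ _ _ _ _ _ _ _ ((candidate_map φ hw h v y x).2 hc) ih1 ih2

/-- An instance on any `n`-element vertex type gives a lower bound on the competitive ratio. -/
lemma le_competitiveRatio [Fintype V] {n : ℕ} (hn : Fintype.card V = n) {s : V}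
    {C O : ℝ} (hO : 0 < O)
    (hwalk : ∃ (r : V) (p : G.Walk r r), (∀ z, z ∈ p.support) ∧ (walkWeight G w p : ℝ) ≤ O)
    (hc : CanCost G w δ s [s] (ENNReal.ofReal C)) :
    ENNReal.ofReal (C / O) ≤ competitiveRatio n δ := by
  classical
  refine le_sInf fun ρ hρ => ?_
  obtain ⟨r, p, hp, hpO⟩ := hwalk
  obtain ⟨h, c, e, hC⟩ := hc
  let eqv : V ≃ Fin n := Fintype.equivFinOfCardEq hn
  let φ : G ≃g G.map eqv.toEmbedding := SimpleGraph.Iso.map eqv G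
  let w' : Sym2 (Fin n) → ℝ≥0 := fun e => w (e.map eqv.symm)
  have hφ : ∀ a, φ a = eqv a := fun a => rfl
  have hw : ∀ a b, w' s(φ a, φ b) = w s(a, b) := fun a b => by simp [w', hφ]
  have hconn : (G.map eqv.toEmbedding).Connected := by
    rw [← φ.connected_iff]
    have : Nonempty V := ⟨s⟩
    refine ⟨fun a b => ?_⟩
    exact ((p.takeUntil a (hp a)).reachable.symm).trans (p.takeUntil b (hp b)).reachable
  have h1 := hρ _ w' hconn (φ s) _ c (by simpa using e.map (w' := w') φ hw)
  have h2 : opt (G.map eqv.toEmbedding) w' ≤ ENNReal.ofReal O := by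
    refine (iInf_le _ (φ r)).trans ((iInf₂_le (p.map φ.toHom) ?_).trans ?_)
    · intro z
      obtain ⟨z, rfl⟩ := φ.surjective z
      rw [SimpleGraph.Walk.support_map]
      exact List.mem_map.2 ⟨z, hp z, rfl⟩
    · rw [walkWeight_map φ hw, ← ENNReal.ofReal_coe_nnreal]
      exact ENNReal.ofReal_le_ofReal hpO
  have h3 : ENNReal.ofReal C ≤ ρ * ENNReal.ofReal O := hC.trans (h1.trans (by gcongr))
  rw [ENNReal.ofReal_div_of_pos hO]
  exact ENNReal.div_le_of_le_mul h3

end Transfer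

/-! ### Brooms: a path of cheap edges with leaves attached to its first vertex -/

section Broom

/-- The path `inl 0, …, inl M` with `m` leaves `inr k` attached to `inl 0`. -/
def broom (M m : ℕ) : SimpleGraph (Fin (M + 1) ⊕ Fin m) where
  Adj
    | .inl i, .inl j => i.val + 1 = j.val ∨ j.val + 1 = i.val
    | .inl i, .inr _ => i.val = 0
    | .inr _, .inl i => i.val = 0
    | .inr _, .inr _ => False
  symm := ⟨by rintro (i | i) (j | j) h <;> simp_all [or_comm]⟩
  loopless := ⟨by rintro (i | i) h <;> simp_all⟩

/-- Path edges have weight `a`, leaf edges have weight `1`. -/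
def broomWeight (M m : ℕ) (a : ℝ≥0) : Sym2 (Fin (M + 1) ⊕ Fin m) → ℝ≥0 :=
  Sym2.lift ⟨fun x y => if x.isRight || y.isRight then 1 else a, fun x y => by
    simp only [Bool.or_comm]⟩

variable {M m : ℕ} {a : ℝ≥0} {δ : ℝ}

@[simp] lemma broom_adj_inl_inl {i j : Fin (M + 1)} :
    (broom M m).Adj (.inl i) (.inl j) ↔ (i.val + 1 = j.val ∨ j.val + 1 = i.val) := Iff.rfl

@[simp] lemma broom_adj_inl_inr {i : Fin (M + 1)} {k : Fin m} :
    (broom M m).Adj (.inl i) (.inr k) ↔ i.val = 0 := Iff.rfl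

@[simp] lemma broom_adj_inr_inl {i : Fin (M + 1)} {k : Fin m} :
    (broom M m).Adj (.inr k) (.inl i) ↔ i.val = 0 := Iff.rfl

@[simp] lemma broom_adj_inr_inr {k k' : Fin m} : ¬ (broom M m).Adj (.inr k) (.inr k') := id

@[simp] lemma broomWeight_inl_inl {i j : Fin (M + 1)} :
    broomWeight M m a s(.inl i, .inl j) = a := rfl

@[simp] lemma broomWeight_inl_inr {i : Fin (M + 1)} {k : Fin m} :
    broomWeight M m a s(.inl i, .inr k) = 1 := rfl

@[simp] lemma broomWeight_inr_inl {i : Fin (M + 1)} {k : Fin m} :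
    broomWeight M m a s(.inr k, .inl i) = 1 := rfl

lemma le_broomWeight (ha : a < 1) (e) : a ≤ broomWeight M m a e := by
  induction e with
  | _ x y =>
    rcases x with x | x <;> rcases y with y | y <;> first | exact le_rfl | exact ha.le

lemma broomWeight_le (ha : a < 1) (e) : broomWeight M m a e ≤ 1 := by
  induction e with
  | _ x y =>
    rcases x with x | x <;> rcases y with y | y <;> first | exact le_rfl | exact ha.le

lemma broom_exploredDist_ge (ha : a < 1) {h : List (Fin (M + 1) ⊕ Fin m)}
    (hh : ∀ i, Sum.inl i ∈ h) :
    ENNReal.ofReal (M * a) ≤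
      exploredDist (broom M m) (broomWeight M m a) h (.inl (Fin.last M)) (.inl 0) := by
  let φ : Fin (M + 1) ⊕ Fin m → ℝ := Sum.elim (fun i => ((M : ℝ) - i.val) * a) (fun _ => M * a)
  have ha' : (a : ℝ) < 1 := by exact_mod_cast ha
  have h0 : (0 : ℝ) ≤ a := a.2
  have := le_exploredDist (G := broom M m) (w := broomWeight M m a) φ (h := h) (y := .inl 0)
    (hh (Fin.last M)) (by
      rintro (i | i) (j | j) hadj - -
      · simp only [broom_adj_inl_inl] at hadj
        simp only [φ, Sum.elim_inl, broomWeight_inl_inl]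
        rcases hadj with h | h
        · rw [← h]; push_cast; nlinarith
        · rw [← h]; push_cast; nlinarith
      · simp only [broom_adj_inl_inr] at hadj
        simp [φ, hadj]
      · simp only [broom_adj_inr_inl] at hadj
        simp [φ, hadj]
      · exact absurd hadj broom_adj_inr_inr)
  simpa [φ] using this

lemma broom_exploredDist_le {h : List (Fin (M + 1) ⊕ Fin m)} (i : ℕ) (hi : i < M + 1)
    (hh : ∀ j : Fin (M + 1), j.val < i → Sum.inl j ∈ h) :
    ∃ p : (broom M m).Walk (.inl 0) (.inl ⟨i, hi⟩),
      (∀ z ∈ p.support, z ≠ .inl ⟨i, hi⟩ → z ∈ h) ∧ walkWeight (broom M m) (broomWeight M m a) p = i * a := by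
  induction i with
  | zero => exact ⟨.nil, by simp, by simp⟩
  | succ i ih =>
    obtain ⟨p, h1, h2⟩ := ih (by omega) (fun j hj => hh j (by omega))
    have hadj : (broom M m).Adj (.inl ⟨i, by omega⟩) (.inl ⟨i + 1, hi⟩) := by simp
    refine ⟨p.append (.cons hadj .nil), ?_, ?_⟩
    · intro z hz hne
      rw [SimpleGraph.Walk.mem_support_append_iff] at hz
      have : z ∈ p.support ∨ z = .inl ⟨i, by omega⟩ := by
        rcases hz with hz | hz
        · exact Or.inl hz
        · simp only [SimpleGraph.Walk.support_cons, SimpleGraph.Walk.support_nil,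
            List.mem_cons, List.not_mem_nil, or_false] at hz
          exact Or.inr (hz.resolve_right hne)
      by_cases hzi : z = .inl ⟨i, by omega⟩
      · rw [hzi]; exact hh _ (by simp)
      · exact h1 z (this.resolve_right hzi) hzi
    · rw [walkWeight_append, h2, walkWeight_cons, walkWeight_nil, broomWeight_inl_inl]
      push_cast; ring

open Classical in
/-- At the end of the path every leaf is reached by a walk along the whole path. -/
lemma broom_canCost_apex (ha : a < 1) (n : ℕ) (h : List (Fin (M + 1) ⊕ Fin m))
    (hh : ∀ i, Sum.inl i ∈ h) (hn : (Finset.univ.filter (fun k : Fin m => Sum.inr k ∉ h)).card = n)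
    (hb : ∃ h₀, h₀ <:+ h ∧ ∀ k, Sum.inr k ∉ h → ∃ u, BlockedBy (broom M m) (broomWeight M m a) δ h₀
      (.inl 0) (.inr k) u (.inl (Fin.last M))) :
    CanCost (broom M m) (broomWeight M m a) δ (.inl (Fin.last M)) h
      (ENNReal.ofReal (n * (M * a))) := by
  induction n generalizing h with
  | zero =>
    obtain ⟨h', c, e⟩ := exists_blockingExec (G := broom M m) (w := broomWeight M m a) (δ := δ)
      (.inl (Fin.last M)) h
    exact ⟨h', c, e, by simp⟩
  | succ n ih =>
    obtain ⟨k, hk⟩ := Finset.card_pos.1 (show 0 < (Finset.univ.filter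
      (fun k : Fin m => Sum.inr k ∉ h)).card by omega)
    have hk' : Sum.inr k ∉ h := by simpa using hk
    obtain ⟨h₀, hs, hb⟩ := hb
    have hc : Candidate (broom M m) (broomWeight M m a) δ h (.inl (Fin.last M)) (.inl 0)
        (.inr k) := by
      refine ⟨⟨by simp, hh 0, hk'⟩, ?_, Or.inr ⟨h₀, hs, hb k hk'⟩⟩
      rintro ⟨u', v', -, ⟨hadj, hu, hv⟩, hlt, -⟩
      rcases v' with v' | v'
      · exact hv (hh v')
      · rcases u' with u' | u'
        · simp at hlt
        · exact broom_adj_inr_inr hadj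
    -- The call at a leaf stops at once: its only neighbour is explored, and no edge was ever
    -- blocked by an edge into a leaf because none weighs more than `1`.
    have hdone : BlockingExec (broom M m) (broomWeight M m a) δ (.inr k) (.inr k :: h)
        (.inr k :: h) 0 := by
      refine .done _ _ ?_
      rintro ⟨y, x, ⟨hadj, hy, hx⟩, -, rfl | ⟨h', -, u, -, ⟨hadj', -⟩, hlt, -⟩⟩
      · rcases x with x | x
        · exact hx (by simp [hh x])
        · exact broom_adj_inr_inr hadj
      · rcases u with u | u
        · rw [broomWeight_inl_inr] at hlt
          exact absurd hlt (not_lt.2 (broomWeight_le ha _))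
        · exact broom_adj_inr_inr hadj'
    have hcard : (Finset.univ.filter (fun k' : Fin m => Sum.inr k' ∉ Sum.inr k :: h)).card = n := by
      have : (Finset.univ.filter (fun k' : Fin m => Sum.inr k' ∉ Sum.inr k :: h)) =
          (Finset.univ.filter (fun k' : Fin m => Sum.inr k' ∉ h)).erase k := by
        ext k'
        simp [Finset.mem_erase]
      rw [this, Finset.card_erase_of_mem hk, hn]
      rfl
    obtain ⟨h₂, c₂, e₂, hC⟩ := ih (.inr k :: h) (fun i => by simp [hh i]) hcard
      ⟨h₀, hs.trans (List.suffix_cons _ _), fun k' hk' => hb k' (fun h' => hk' (by simp [h']))⟩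
    refine ⟨_, _, .step _ _ _ _ _ _ _ _ hc hdone e₂, ?_⟩
    have h1 := broom_exploredDist_ge ha hh
    calc ENNReal.ofReal ((n + 1 : ℕ) * (M * a))
        = ENNReal.ofReal (M * a) + ENNReal.ofReal (n * (M * a)) := by
          rw [← ENNReal.ofReal_add (by positivity) (by positivity)]
          congr 1; push_cast; ring
      _ ≤ _ := by
        refine add_le_add (h1.trans ?_) hC
        exact (le_self_add.trans le_self_add).trans le_self_add

/-- Path edges have minimal weight, so they are never blocked and the agent may follow them to the
end. `hδ` makes the last of them block all leaf edges just before the end is reached. -/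
lemma broom_canCost_path (ha : a < 1) (hδ : M * (a : ℝ) ≤ 1 + δ) (i : ℕ)
    (hi : i < M)
    (h : List (Fin (M + 1) ⊕ Fin m)) (hh : ∀ x, x ∈ h ↔ ∃ j, j.val ≤ i ∧ x = Sum.inl j) :
    CanCost (broom M m) (broomWeight M m a) δ (.inl ⟨i, hi.trans (Nat.lt_succ_self M)⟩) h
      (ENNReal.ofReal (m * (M * a))) := by
  classical
  induction hr : M - i generalizing i h with
  | zero => omega
  | succ r ih =>
    have hi' : i + 1 < M + 1 := by omega
    have hadj : (broom M m).Adj (.inl ⟨i, hi.trans (Nat.lt_succ_self M)⟩) (.inl ⟨i + 1, hi'⟩) := by simp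
    have hbd : Boundary (broom M m) h (.inl ⟨i, hi.trans (Nat.lt_succ_self M)⟩) (.inl ⟨i + 1, hi'⟩) := by
      refine ⟨hadj, (hh _).2 ⟨_, le_rfl, rfl⟩, fun hx => ?_⟩
      obtain ⟨j, hj, hij⟩ := (hh _).1 hx
      cases hij
      simp at hj
    have hc : Candidate (broom M m) (broomWeight M m a) δ h (.inl ⟨i, hi.trans (Nat.lt_succ_self M)⟩) (.inl ⟨i, hi.trans (Nat.lt_succ_self M)⟩)
        (.inl ⟨i + 1, hi'⟩) := by
      refine ⟨hbd, ?_, Or.inl rfl⟩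
      rintro ⟨u', v', -, -, hlt, -⟩
      exact absurd hlt (not_lt.2 (le_broomWeight ha _))
    have hh' : ∀ x, x ∈ (Sum.inl ⟨i + 1, hi'⟩ :: h : List (Fin (M + 1) ⊕ Fin m)) ↔
        ∃ j, j.val ≤ i + 1 ∧ x = Sum.inl j := by
      intro x
      rw [List.mem_cons, hh]
      constructor
      · rintro (rfl | ⟨j, hj, rfl⟩)
        · exact ⟨_, le_rfl, rfl⟩
        · exact ⟨j, hj.trans (Nat.le_succ i), rfl⟩
      · rintro ⟨j, hj, rfl⟩
        rcases Nat.lt_or_ge i j.val with h1 | h1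
        · left; congr 1; ext; simp; omega
        · exact Or.inr ⟨j, h1, rfl⟩
    refine CanCost.of_call hc ?_
    by_cases hlast : i + 1 = M
    · subst hlast
      have hleaf : ∀ k, Sum.inr k ∉ (Sum.inl ⟨i + 1, hi'⟩ :: h : List (Fin (i + 1 + 1) ⊕ Fin m)) := by
        intro k hk
        obtain ⟨j, -, hj⟩ := (hh' _).1 hk
        cases hj
      refine broom_canCost_apex ha m _ (fun j => (hh' _).2 ⟨j, by omega, rfl⟩) ?_
        ⟨h, List.suffix_cons _ _, fun k _ => ⟨.inl ⟨i, hi.trans (Nat.lt_succ_self _)⟩, ?_⟩⟩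
      · rw [Finset.filter_true_of_mem (fun k _ => hleaf k)]; simp
      · refine ⟨⟨by simp, (hh _).2 ⟨0, by simp, rfl⟩, fun hk => hleaf k (by simp [hk])⟩, hbd,
          by simpa using ha, ?_⟩
        obtain ⟨p, hp1, hp2⟩ := broom_exploredDist_le (m := m) (a := a) (h := h) (i + 1) hi'
          (fun j hj => (hh _).2 ⟨j, by omega, rfl⟩)
        refine (exploredDist_le_walkWeight p hp1).trans ?_
        rw [hp2, ← ENNReal.ofReal_coe_nnreal]
        refine ENNReal.ofReal_le_ofReal ?_
        push_cast at hδ ⊢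
        simpa using hδ
    · exact ih (i + 1) (by omega) _ hh' (by omega)

lemma broom_exists_closed_walk :
    ∃ (r : _) (p : (broom M m).Walk r r), (∀ z, z ∈ p.support) ∧
      (walkWeight (broom M m) (broomWeight M m a) p : ℝ) ≤ 2 * (M * a + m) := by
  obtain ⟨p, h1, h2⟩ := exists_closed_walk_of_parent (G := broom M m) (w := broomWeight M m a)
    (.inl 0)
    (Sum.elim (fun i => .inl ⟨i.val - 1, by omega⟩) (fun _ => .inl 0))
    (Sum.elim (fun i => i.val) (fun _ => M + 1))
    (Sum.elim (fun i => if i = 0 then 0 else a) (fun _ => 1)) (by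
      rintro (i | i) hi
      · have : i.val ≠ 0 := fun h => hi (by congr 1; ext; simpa using h)
        have h' : i ≠ 0 := fun h => hi (by rw [h])
        refine ⟨?_, ?_, ?_⟩
        · simp only [Sum.elim_inl, broom_adj_inl_inl]; omega
        · simp only [Sum.elim_inl]; omega
        · simp [h']
      · refine ⟨by simp, by simp, by simp⟩)
  refine ⟨_, p, h1, ?_⟩
  have h3 : (∑ x, Sum.elim (fun i : Fin (M + 1) => if i = 0 then 0 else a) (fun _ : Fin m => 1) x)
      = M * a + m := by
    rw [Fintype.sum_sum_type]
    simp [Fin.sum_univ_succ]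
  rw [h3] at h2
  exact_mod_cast h2

/-- For large `δ`, the competitive ratio is at least of the order `min δ n`. -/
lemma competitiveRatio_ge_of_le (n m : ℕ) (hm : 0 < m) (hn : 4 * m ≤ n) (hδ : (m : ℝ) ≤ δ) :
    ENNReal.ofReal ((m : ℝ) / 4) ≤ competitiveRatio n δ := by
  obtain ⟨M, rfl⟩ : ∃ M, n = M + 1 + m := ⟨n - 1 - m, by omega⟩
  have hM : 0 < M := by omega
  have hMm : m < M := by omega
  -- The path gets total weight `m`, equal to that of the leaves, whatever number of vertices is
  -- left for it.
  let a : ℝ≥0 := m / M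
  have hMR : (0 : ℝ) < M := by exact_mod_cast hM
  have ha : a < 1 := by
    rw [div_lt_one (by exact_mod_cast hM)]
    exact_mod_cast hMm
  have hMa : (M : ℝ) * a = m := by
    simp only [a]; push_cast; field_simp
  have hmR : (0 : ℝ) < m := by exact_mod_cast hm
  have h1 := broom_canCost_path (m := m) (δ := δ) ha (by rw [hMa]; linarith) 0 hM [.inl 0]
    (by
      intro x
      simp only [List.mem_singleton]
      constructor
      · rintro rfl; exact ⟨0, by simp, rfl⟩
      · rintro ⟨j, hj, rfl⟩; congr 1; ext; simpa using hj)
  have h2 := le_competitiveRatio (n := M + 1 + m) (by simp) (O := 2 * (M * a + m))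
    (by rw [hMa]; positivity) (broom_exists_closed_walk (m := m) (a := a)) h1
  rw [hMa] at h2
  convert h2 using 2
  field_simp
  norm_num
end Broom

/-! ### Uniform hypergraphs without short cycles -/

section Hypergraph

variable {A : Type*}

-- Greedy choice: each selected element excludes at most `B` elements.
open Classical in
lemma exists_pairwise_not_rel (C : A → A → Prop) (hrefl : ∀ k, C k k)
    (hsymm : ∀ k k', C k k' → C k' k) [Fintype A] {B : ℕ}
    (hB0 : 0 < B) (hB : ∀ k, (Finset.univ.filter (C k)).card ≤ B) (d : ℕ) (X : Finset A)
    (hX : d * B ≤ X.card) :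
    ∃ Y ⊆ X, Y.card = d ∧ ∀ k ∈ Y, ∀ k' ∈ Y, k ≠ k' → ¬ C k k' := by
  induction d generalizing X with
  | zero => exact ⟨∅, by simp, by simp, by simp⟩
  | succ d ih =>
    have hne : X.Nonempty := Finset.card_pos.1 (lt_of_lt_of_le (by positivity) hX)
    obtain ⟨k, hk⟩ := hne
    obtain ⟨Y, hY, hcard, hfar⟩ := ih (X.filter (fun k' => ¬ C k k')) (by
      have h1 := Finset.card_filter_add_card_filter_not (s := X) (C k)
      have h2 : (X.filter (C k)).card ≤ B :=
        (Finset.card_le_card (Finset.filter_subset_filter _ (Finset.subset_univ _))).trans (hB k)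
      rw [add_mul] at hX
      omega)
    have hY' : ∀ k' ∈ Y, k' ∈ X ∧ ¬ C k k' := fun k' h => by simpa using hY h
    have hkY : k ∉ Y := fun h => (hY' k h).2 (hrefl k)
    refine ⟨insert k Y, ?_, by rw [Finset.card_insert_of_notMem hkY, hcard], ?_⟩
    · intro x hx
      rcases Finset.mem_insert.1 hx with rfl | hx
      · exact hk
      · exact (hY' x hx).1
    · intro x hx x' hx' hxx
      rw [Finset.mem_insert] at hx hx'
      rcases hx with hx1 | hx1 <;> rcases hx' with hx2 | hx2
      · exact absurd (hx1.trans hx2.symm) hxx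
      · rw [hx1]; exact (hY' _ hx2).2
      · rw [hx2]; exact fun h => (hY' _ hx1).2 (hsymm _ _ h)
      · exact hfar x hx1 x' hx2 hxx

/-- Two vertices are adjacent if they lie in a common hyperedge `S i` with `i < j`. -/
def linkGraph (S : ℕ → Finset A) (j : ℕ) : SimpleGraph A :=
  SimpleGraph.fromRel fun k k' => ∃ i < j, k ∈ S i ∧ k' ∈ S i

lemma linkGraph_adj {S : ℕ → Finset A} {j : ℕ} {k k' : A} :
    (linkGraph S j).Adj k k' ↔ k ≠ k' ∧ ∃ i < j, k ∈ S i ∧ k' ∈ S i := by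
  simp only [linkGraph, SimpleGraph.fromRel_adj]
  refine and_congr_right fun _ => ⟨?_, Or.inl⟩
  rintro (h | ⟨i, hi, h1, h2⟩)
  · exact h
  · exact ⟨i, hi, h2, h1⟩

lemma linkGraph_congr {S S' : ℕ → Finset A} {j : ℕ} (h : ∀ i < j, S i = S' i) :
    linkGraph S j = linkGraph S' j := by
  ext k k'
  simp only [linkGraph_adj]
  refine and_congr_right fun _ => exists_congr fun i => and_congr_right fun hi => ?_
  rw [h i hi]

open Classical in
lemma card_edist_le (G : SimpleGraph A) [Fintype A] {D : ℕ}
    (hD : ∀ k, (Finset.univ.filter (G.Adj k)).card ≤ D) (k : A) (m : ℕ) :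
    (Finset.univ.filter (fun k' => G.edist k k' ≤ m)).card ≤ (D + 1) ^ m := by
  induction m with
  | zero =>
    have : Finset.univ.filter (fun k' => G.edist k k' ≤ (0 : ℕ)) = {k} := by
      ext k'; simp [SimpleGraph.edist_eq_zero_iff, eq_comm (a := k)]
    rw [this]; simp
  | succ m ih =>
    have hsub : Finset.univ.filter (fun k' => G.edist k k' ≤ (m + 1 : ℕ)) ⊆
        (Finset.univ.filter (fun k' => G.edist k k' ≤ m)).biUnion
          (fun x => insert x (Finset.univ.filter (G.Adj x))) := by
      intro k' hk'
      simp only [Finset.mem_filter, Finset.mem_univ, true_and] at hk'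
      simp only [Finset.mem_biUnion, Finset.mem_filter, Finset.mem_univ, true_and,
        Finset.mem_insert]
      rw [SimpleGraph.edist_comm] at hk'
      obtain ⟨p, hp⟩ := SimpleGraph.exists_walk_of_edist_ne_top
        (ne_top_of_le_ne_top (ENat.natCast_ne_top _) hk')
      rw [← hp, Nat.cast_le] at hk'
      cases p with
      | nil => exact ⟨_, by simp, Or.inl rfl⟩
      | cons ha q =>
        refine ⟨_, ?_, Or.inr ha.symm⟩
        rw [SimpleGraph.edist_comm]
        refine (SimpleGraph.edist_le q).trans ?_
        rw [SimpleGraph.Walk.length_cons] at hk'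
        exact_mod_cast (by omega : q.length ≤ m)
    refine (Finset.card_le_card hsub).trans ((Finset.card_biUnion_le_card_mul _ _ (D + 1)
      fun x _ => (Finset.card_insert_le _ _).trans (by have := hD x; omega)).trans ?_)
    rw [pow_succ]
    gcongr

-- A vertex lies in at most `d` hyperedges, each contributing at most `d` neighbours.
open Classical in
lemma card_linkGraph_adj_le [Fintype A] {S : ℕ → Finset A} {j d : ℕ}
    (hS : ∀ i < j, (S i).card = d)
    (hdeg : ∀ k, ((Finset.range j).filter (fun i => k ∈ S i)).card ≤ d) (k : A) :
    (Finset.univ.filter ((linkGraph S j).Adj k)).card ≤ d ^ 2 := by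
  have hsub : Finset.univ.filter ((linkGraph S j).Adj k) ⊆
      ((Finset.range j).filter (fun i => k ∈ S i)).biUnion S := by
    intro k' hk'
    simp only [Finset.mem_filter, Finset.mem_univ, true_and, linkGraph_adj] at hk'
    obtain ⟨-, i, hi, h1, h2⟩ := hk'
    simp only [Finset.mem_biUnion, Finset.mem_filter, Finset.mem_range]
    exact ⟨i, ⟨hi, h1⟩, h2⟩
  refine (Finset.card_le_card hsub).trans ((Finset.card_biUnion_le_card_mul _ _ d
    fun x hx => ?_).trans ?_)
  · simp only [Finset.mem_filter, Finset.mem_range] at hx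
    exact (hS x hx.1).le
  · rw [pow_two]; gcongr; exact hdeg k

open Classical in
/-- Greedy construction of `j ≤ N` hyperedges of size `d` on `2 N` vertices, each of whose pairs
of vertices is at distance more than `g` in the hypergraph formed by the earlier hyperedges. -/
lemma exists_hyperedges {N d g : ℕ} (hd : 0 < d) (hN : d * (d ^ 2 + 1) ^ g ≤ N) (j : ℕ)
    (hj : j ≤ N) : ∃ S : ℕ → Finset (Fin (2 * N)), (∀ i < j, (S i).card = d) ∧
      (∀ k, ((Finset.range j).filter (fun i => k ∈ S i)).card ≤ d) ∧
      ∀ i < j, ∀ k ∈ S i, ∀ k' ∈ S i, k ≠ k' → ¬ (linkGraph S i).edist k k' ≤ g := by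
  induction j with
  | zero => exact ⟨fun _ => ∅, by simp, by simp, by simp⟩
  | succ j ih =>
    obtain ⟨S, h1, h2, h3⟩ := ih (by omega)
    -- The vertices of degree still below `d`. By double counting at most `j` vertices are
    -- saturated, so at least `N` of the `2 * N` vertices remain. Balls of radius `g` have at most
    -- `(d ^ 2 + 1) ^ g` elements, so `d` pairwise distant vertices can be picked among them.
    let X : Finset (Fin (2 * N)) :=
      Finset.univ.filter fun k => ((Finset.range j).filter (fun i => k ∈ S i)).card < d
    have hX : N ≤ X.card := by
      have hsum : ∑ k, ((Finset.range j).filter (fun i => k ∈ S i)).card = j * d := by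
        simp only [Finset.card_filter]
        rw [Finset.sum_comm]
        rw [Finset.sum_congr rfl (g := fun _ => d) (fun i hi => by
          rw [← Finset.card_filter, Finset.filter_univ_mem]
          exact h1 i (Finset.mem_range.1 hi))]
        simp
      have hle : (Finset.univ.filter fun k : Fin (2 * N) =>
          ¬ ((Finset.range j).filter (fun i => k ∈ S i)).card < d).card * d ≤ j * d := by
        rw [← hsum, ← smul_eq_mul]
        refine (Finset.card_nsmul_le_sum _ _ d fun k hk => ?_).trans
          (Finset.sum_le_sum_of_subset (Finset.subset_univ _))
        simpa using hk
      have hle' := Nat.le_of_mul_le_mul_right hle hd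
      have := Finset.card_filter_add_card_filter_not (s := (Finset.univ : Finset (Fin (2 * N))))
        (fun k => ((Finset.range j).filter (fun i => k ∈ S i)).card < d)
      rw [Finset.card_univ, Fintype.card_fin] at this
      change N ≤ (Finset.univ.filter fun k : Fin (2 * N) =>
        ((Finset.range j).filter (fun i => k ∈ S i)).card < d).card
      omega
    obtain ⟨Y, hYX, hYd, hYfar⟩ := exists_pairwise_not_rel
      (fun k k' => (linkGraph S j).edist k k' ≤ g) (fun k => by simp)
      (fun k k' h => by rwa [SimpleGraph.edist_comm])
      (by positivity) (fun k => by
        convert card_edist_le _ (card_linkGraph_adj_le h1 (fun k => by convert h2 k)) k g) d X (hN.trans hX)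
    have hupd : ∀ i < j, Function.update S j Y i = S i := fun i hi =>
      Function.update_of_ne (by omega) _ _
    refine ⟨Function.update S j Y, ?_, ?_, ?_⟩
    · intro i hi
      rcases Nat.lt_succ_iff_lt_or_eq.1 hi with hi | rfl
      · rw [hupd i hi]; exact h1 i hi
      · simpa using hYd
    · intro k
      have hfil : (Finset.range j).filter (fun i => k ∈ Function.update S j Y i) =
          (Finset.range j).filter (fun i => k ∈ S i) :=
        Finset.filter_congr fun i hi => by rw [hupd i (Finset.mem_range.1 hi)]
      rw [Finset.range_add_one, Finset.filter_insert, hfil]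
      split_ifs with hk
      · rw [Function.update_self] at hk
        have := hYX hk
        simp only [X, Finset.mem_filter, Finset.mem_univ, true_and] at this
        exact (Finset.card_insert_le _ _).trans this
      · exact h2 k
    · intro i hi
      rcases Nat.lt_succ_iff_lt_or_eq.1 hi with hi | rfl
      · rw [hupd i hi, linkGraph_congr (S' := S) (fun i' hi' => hupd i' (by omega))]
        exact h3 i hi
      · rw [Function.update_self, linkGraph_congr (S' := S) (fun i' hi' => hupd i' hi')]
        exact hYfar

/-- A family of `N` hyperedges of size `d` on `2 N` vertices.  For every vertex `k₀` of a
hyperedge, there is a potential that vanishes at `k₀`, varies by at most `2` on each earlier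
hyperedge, and reaches `δ` on the rest of the hyperedge. -/
lemma exists_sparse_hypergraph {δ : ℝ} (hδ0 : 0 ≤ δ) {N d g : ℕ} (hδ : δ ≤ 2 * (g + 1))
    (hd : 0 < d) (hN : d * (d ^ 2 + 1) ^ g ≤ N) :
    ∃ f : Fin N → Fin d → Fin (2 * N), ∀ (j : Fin N) (i₀ : Fin d), ∃ a : Fin (2 * N) → ℝ, a (f j i₀) = 0 ∧
      (∀ k, 0 ≤ a k ∧ a k ≤ δ) ∧ (∀ j' < j, ∀ i i', |a (f j' i) - a (f j' i')| ≤ 2) ∧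
      ∀ i, i ≠ i₀ → a (f j i) = δ := by
  classical
  obtain ⟨S, h1, -, h3⟩ := exists_hyperedges hd hN N le_rfl
  let f : Fin N → Fin d → Fin (2 * N) := fun j => (S j).orderEmbOfFin (h1 j j.2)
  have hf : ∀ (j : Fin N) (i : Fin d), f j i ∈ S j := fun j i => Finset.orderEmbOfFin_mem _ _ _
  refine ⟨f, fun j i₀ => ?_⟩
  set G := linkGraph S j with hG
  -- Twice the distance from `f j i₀`, cut off at `δ`. Other vertices of the hyperedge are at
  -- distance at least `g + 1`, hence reach the cutoff since `δ ≤ 2 * (g + 1)`.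
  let a : Fin (2 * N) → ℝ := fun k =>
    if G.edist (f j i₀) k = ⊤ then δ else min δ (2 * (G.edist (f j i₀) k).toNat)
  have haux : ∀ k k', G.Adj k k' → a k' ≤ a k + 2 := by
    intro k k' hadj
    have htri := G.edist_triangle (u := f j i₀) (v := k) (w := k')
    rw [SimpleGraph.edist_eq_one_iff_adj.2 hadj] at htri
    simp only [a]
    by_cases hk : G.edist (f j i₀) k = ⊤
    · rw [if_pos hk]
      split_ifs
      · linarith
      · linarith [min_le_left δ (2 * ((G.edist (f j i₀) k').toNat : ℝ))]
    · obtain ⟨e, he⟩ := ENat.ne_top_iff_exists.1 hk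
      rw [← he] at htri
      have hk' : G.edist (f j i₀) k' ≠ ⊤ := ne_top_of_le_ne_top (by
        exact ENat.natCast_ne_top (e + 1)) htri
      obtain ⟨e', he'⟩ := ENat.ne_top_iff_exists.1 hk'
      rw [← he'] at htri
      have hee : e' ≤ e + 1 := by exact_mod_cast htri
      rw [if_neg hk, if_neg hk', ← he, ← he']
      simp only [ENat.toNat_natCast]
      have : (e' : ℝ) ≤ e + 1 := by exact_mod_cast hee
      rw [← min_add_add_right]
      exact min_le_min (by linarith) (by linarith)
  refine ⟨a, ?_, ?_, ?_, ?_⟩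
  · simp [a, hδ0]
  · intro k
    simp only [a]
    split_ifs
    · exact ⟨hδ0, le_rfl⟩
    · exact ⟨le_min hδ0 (by positivity), min_le_left _ _⟩
  · intro j' hj' i i'
    by_cases hii : f j' i = f j' i'
    · rw [hii]; simp
    · have hadj : G.Adj (f j' i) (f j' i') := linkGraph_adj.2 ⟨hii, j'.val, hj', hf _ _, hf _ _⟩
      rw [abs_le]
      constructor
      · linarith [haux _ _ hadj]
      · linarith [haux _ _ hadj.symm]
  · intro i hi
    have hne : f j i₀ ≠ f j i := fun h => hi ((Finset.orderEmbOfFin _ _).injective h).symm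
    have hfar := h3 j j.2 _ (hf j i₀) _ (hf j i) hne
    simp only [a]
    split_ifs with htop
    · rfl
    · obtain ⟨e, he⟩ := ENat.ne_top_iff_exists.1 htop
      rw [← hG, ← he] at hfar
      have hge : g + 1 ≤ e := by
        by_contra hcon
        exact hfar (by exact_mod_cast (by omega : e ≤ g))
      rw [← he, ENat.toNat_natCast, min_eq_left]
      have : ((g : ℝ) + 1) ≤ e := by exact_mod_cast hge
      linarith

end Hypergraph

/-! ### Hub graphs -/

section Reach

variable {V : Type*} {G : SimpleGraph V} {w : Sym2 V → ℝ≥0}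

/-- `x` and `y` are joined by a walk of weight `L` through explored vertices. -/
def ExploredWalk (G : SimpleGraph V) (w : Sym2 V → ℝ≥0) (h : List V) (x y : V) (L : ℝ≥0) : Prop :=
  ∃ p : G.Walk x y, (∀ z ∈ p.support, z ∈ h) ∧ walkWeight G w p = L

lemma ExploredWalk.symm {h : List V} {x y : V} {L : ℝ≥0} (p : ExploredWalk G w h x y L) :
    ExploredWalk G w h y x L := by
  obtain ⟨p, h1, h2⟩ := p
  exact ⟨p.reverse, by simpa using h1, by rw [walkWeight_reverse, h2]⟩

lemma ExploredWalk.trans {h : List V} {x y z : V} {L L' : ℝ≥0} (p : ExploredWalk G w h x y L)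
    (q : ExploredWalk G w h y z L') : ExploredWalk G w h x z (L + L') := by
  obtain ⟨p, h1, h2⟩ := p
  obtain ⟨q, h3, h4⟩ := q
  refine ⟨p.append q, fun t ht => ?_, by rw [walkWeight_append, h2, h4]⟩
  rw [SimpleGraph.Walk.mem_support_append_iff] at ht
  exact ht.elim (h1 t) (h3 t)

lemma ExploredWalk.of_adj {h : List V} {x y : V} (hx : x ∈ h) (hy : y ∈ h) (ha : G.Adj x y) :
    ExploredWalk G w h x y (w s(x, y)) :=
  ⟨.cons ha .nil, by simp [hx, hy], by simp⟩

/-- The last vertex `v` may be unexplored; this is the form in which blocking edges are found. -/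
lemma ExploredWalk.exploredDist_le {h : List V} {x y v : V} {L : ℝ≥0}
    (p : ExploredWalk G w h x y L) (ha : G.Adj y v) :
    exploredDist G w h x v ≤ (L + w s(y, v) : ℝ≥0) := by
  obtain ⟨p, h1, h2⟩ := p
  have := exploredDist_le_walkWeight (w := w) (h := h) (p.append (.cons ha .nil)) (fun z hz hne => by
    rw [SimpleGraph.Walk.mem_support_append_iff] at hz
    rcases hz with hz | hz
    · exact h1 z hz
    · simp only [SimpleGraph.Walk.support_cons, SimpleGraph.Walk.support_nil, List.mem_cons,
        List.not_mem_nil, or_false] at hz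
      rw [hz.resolve_right hne]
      exact h1 _ p.end_mem_support)
  rwa [walkWeight_append, h2, walkWeight_cons, walkWeight_nil, add_zero] at this

end Reach

/-! ### Lipschitz functions along the spine. -/

section Interpolation

/-- Piecewise linear interpolation of the values `c q` at the multiples `q * R`. -/
noncomputable def interp (R : ℕ) (c : ℕ → ℝ) (i : ℕ) : ℝ :=
  c (i / R) + (c (i / R + 1) - c (i / R)) * ((i % R : ℕ) / R)

lemma interp_mul {R : ℕ} (hR : 0 < R) (c : ℕ → ℝ) (q : ℕ) : interp R c (q * R) = c q := by
  simp [interp, Nat.mul_div_cancel _ hR]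

lemma abs_interp_succ_sub_le {R : ℕ} (hR : 0 < R) (c : ℕ → ℝ) {B : ℝ}
    (hc : ∀ q, |c (q + 1) - c q| ≤ R * B) (i : ℕ) :
    |interp R c (i + 1) - interp R c i| ≤ B := by
  have hR' : (0 : ℝ) < R := by exact_mod_cast hR
  have key : interp R c (i + 1) =
      c (i / R) + (c (i / R + 1) - c (i / R)) * (((i % R : ℕ) + 1) / R) := by
    -- Both `i` and `i + 1` are expressed on the segment containing `i`. When `i + 1` is a multiple
    -- of `R`, its value from the next segment agrees.
    have hdm := Nat.div_add_mod' i R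
    by_cases hs : i % R + 1 < R
    · have h1 : (i + 1) / R = i / R := by
        rw [Nat.div_eq_of_lt_le]
        · omega
        · rw [add_mul]; omega
      have h2 : (i + 1) % R = i % R + 1 := by
        rw [Nat.add_mod, Nat.mod_eq_of_lt (a := 1) (by omega), Nat.mod_eq_of_lt hs]
      rw [interp, h1, h2]; push_cast; rfl
    · have hs' : i % R + 1 = R := by have := Nat.mod_lt i hR; omega
      have h1 : i + 1 = (i / R + 1) * R := by rw [add_mul]; omega
      have h2 : ((i % R : ℕ) : ℝ) + 1 = R := by exact_mod_cast hs'
      rw [h1, interp_mul hR, h2, div_self hR'.ne']; ring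
  rw [key, interp]
  have : c (i / R) + (c (i / R + 1) - c (i / R)) * (((i % R : ℕ) + 1) / R) -
      (c (i / R) + (c (i / R + 1) - c (i / R)) * ((i % R : ℕ) / R)) =
      (c (i / R + 1) - c (i / R)) / R := by
    field_simp; ring
  rw [this, abs_div, abs_of_pos hR', div_le_iff₀ hR', mul_comm B]
  exact hc _

end Interpolation

/-- The data of a hub graph: `N` clusters with `d` links each, arms with `K + 1` vertices, spine
segments with `R` edges, `r + 1` tip vertices, the incidences `f` between clusters and arms, the
weights `α` and `ε` of the cheap edges and the weights `W` of the heavy edges. -/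
structure HubData where
  N : ℕ
  d : ℕ
  K : ℕ
  R : ℕ
  r : ℕ
  f : Fin N → Fin d → Fin (2 * N)
  α : ℝ≥0
  ε : ℝ≥0
  W : Fin N → ℝ≥0

namespace HubData

/-- The vertices of the hub graph: the spine with the cluster centers at the multiples of `R` and
the hub at its end, the arms and the tip attached to the hub, the links attached to the centers,
and the ports, each of which is joined to a link and, by a heavy edge, to the end of an arm. -/
inductive Vertex (D : HubData) : Type
  | spine (i : Fin (D.N * D.R + 1))
  | arm (k : Fin (2 * D.N)) (i : Fin (D.K + 1))
  | tip (i : Fin (D.r + 1))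
  | link (j : Fin D.N) (i : Fin D.d)
  | port (j : Fin D.N) (i : Fin D.d)

variable {D : HubData}

open Vertex

/-- The vertices as a sum type. -/
def vertexEquiv (D : HubData) : D.Vertex ≃
    (Fin (D.N * D.R + 1) ⊕ (Fin (2 * D.N) × Fin (D.K + 1))) ⊕ Fin (D.r + 1) ⊕
      (Fin D.N × Fin D.d) ⊕ (Fin D.N × Fin D.d) where
  toFun
    | spine i => .inl (.inl i)
    | arm k i => .inl (.inr (k, i))
    | tip i => .inr (.inl i)
    | link j i => .inr (.inr (.inl (j, i)))
    | port j i => .inr (.inr (.inr (j, i)))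
  invFun
    | .inl (.inl i) => spine i
    | .inl (.inr (k, i)) => arm k i
    | .inr (.inl i) => tip i
    | .inr (.inr (.inl (j, i))) => link j i
    | .inr (.inr (.inr (j, i))) => port j i
  left_inv := by rintro (_ | _ | _ | _ | _) <;> rfl
  right_inv := by rintro ((_ | ⟨_, _⟩) | _ | ⟨_, _⟩ | ⟨_, _⟩) <;> rfl

instance : Fintype D.Vertex := Fintype.ofEquiv _ D.vertexEquiv.symm

lemma card_vertex (D : HubData) : Fintype.card D.Vertex =
    (D.N * D.R + 1 + 2 * D.N * (D.K + 1)) + (D.r + 1 + (D.N * D.d + D.N * D.d)) := by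
  rw [Fintype.card_congr D.vertexEquiv]
  simp

/-- The edges of the hub graph, oriented away from the start. -/
def Arc (D : HubData) : D.Vertex → D.Vertex → Prop
  | spine i, spine i' => i.val + 1 = i'.val
  | spine i, arm _ i' => i.val = D.N * D.R ∧ i'.val = 0
  | spine i, tip i' => i.val = D.N * D.R ∧ i'.val = 0
  | spine i, link j _ => i.val = j.val * D.R
  | arm k i, arm k' i' => k = k' ∧ i.val + 1 = i'.val
  | arm k i, port j i' => k = D.f j i' ∧ i.val = D.K
  | tip i, tip i' => i.val + 1 = i'.val
  | link j i, port j' i' => j = j' ∧ i = i'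
  | _, _ => False

/-- The hub graph. -/
def graph (D : HubData) : SimpleGraph D.Vertex where
  Adj x y := D.Arc x y ∨ D.Arc y x
  symm := ⟨fun _ _ h => h.symm⟩
  loopless := ⟨by rintro (_ | _ | _ | _ | _) h <;> simp [Arc] at h⟩

/-- The weight of an edge depends only on the kinds of its ends. -/
def weightFun (D : HubData) : D.Vertex → D.Vertex → ℝ≥0
  | spine _, spine _ => D.ε
  | spine _, arm _ _ => D.α
  | arm _ _, spine _ => D.α
  | arm _ _, arm _ _ => D.α
  | spine _, tip _ => D.α
  | tip _, spine _ => D.α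
  | spine _, link _ _ => D.ε
  | link _ _, spine _ => D.ε
  | link _ _, port _ _ => D.ε
  | port _ _, link _ _ => D.ε
  | arm _ _, port j _ => D.W j
  | port j _, arm _ _ => D.W j
  | _, _ => 0

/-- The edge weights of the hub graph. -/
def weight (D : HubData) : Sym2 D.Vertex → ℝ≥0 :=
  Sym2.lift ⟨D.weightFun, by rintro (_ | _ | _ | _ | _) (_ | _ | _ | _ | _) <;> rfl⟩

@[simp] lemma weight_mk (x y : D.Vertex) : D.weight s(x, y) = D.weightFun x y := rfl

lemma adj_iff {x y : D.Vertex} : D.graph.Adj x y ↔ D.Arc x y ∨ D.Arc y x := Iff.rfl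

/-- The center of a cluster. -/
def center (D : HubData) (j : Fin D.N) : D.Vertex :=
  spine ⟨j.val * D.R, Nat.lt_succ_of_le (Nat.mul_le_mul_right _ j.2.le)⟩

/-- The hub. -/
def hub (D : HubData) : D.Vertex := spine (Fin.last _)

/-- The end of an arm. -/
def armEnd (D : HubData) (k : Fin (2 * D.N)) : D.Vertex := arm k (Fin.last _)

/-- The last vertex of the tip. -/
def apex (D : HubData) : D.Vertex := tip (Fin.last _)

/-- The requirements on the data of a hub graph. -/
structure Good (D : HubData) (δ : ℝ) : Prop where
  δ_pos : 0 < δ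
  N_pos : 0 < D.N
  d_pos : 0 < D.d
  R_pos : 0 < D.R
  arm_length : 2 * ((D.K + 1) * (D.α : ℝ)) = δ
  α_le : D.α ≤ D.ε
  ε_mul_lt : (1 + δ) * (D.ε : ℝ) < 1
  le_R_mul : δ + 2 ≤ D.R * (D.ε : ℝ)
  one_le_W : ∀ j, 1 ≤ D.W j
  W_le_two : ∀ j, D.W j ≤ 2
  W_strictMono : StrictMono D.W
  W_close : ∀ j, δ * ((D.W j : ℝ) - 1) < D.ε
  sparse : ∀ j i₀, ∃ a : Fin (2 * D.N) → ℝ, a (D.f j i₀) = 0 ∧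
      (∀ k, 0 ≤ a k ∧ a k ≤ δ) ∧ (∀ j' < j, ∀ i i', |a (D.f j' i) - a (D.f j' i')| ≤ 2) ∧
      ∀ i, i ≠ i₀ → a (D.f j i) = δ

variable {δ : ℝ}

namespace Good

lemma α_pos (g : D.Good δ) : (0 : ℝ) < D.α := by
  have := g.arm_length
  have h1 := g.δ_pos
  by_contra hcon
  have h2 : (D.α : ℝ) = 0 := le_antisymm (not_lt.1 hcon) D.α.2
  rw [h2] at this
  linarith

lemma α_le_half (g : D.Good δ) : 2 * (D.α : ℝ) ≤ δ := by
  have := g.arm_length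
  have h1 := g.α_pos
  have h2 : (0 : ℝ) ≤ D.K := Nat.cast_nonneg _
  nlinarith

lemma ε_lt_one (g : D.Good δ) : D.ε < 1 := by
  have h1 := g.ε_mul_lt
  have h2 := g.δ_pos
  have h3 : (0 : ℝ) ≤ D.ε := D.ε.2
  have : (D.ε : ℝ) < 1 := by nlinarith
  exact_mod_cast this

end Good

/-- The potentials used to bound explored distances from below: `c` at the multiples of `R` on the
spine, `b` at the ends of the arms, `t` on the tip, `l` and `p` at links and ports. -/
noncomputable def potential (D : HubData) (c : ℕ → ℝ) (b : Fin (2 * D.N) → ℝ) (t : ℝ)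
    (l p : Fin D.N → Fin D.d → ℝ) : D.Vertex → ℝ
  | spine i => interp D.R c i
  | arm k i => c D.N + (b k - c D.N) * ((i.val + 1) / (D.K + 1))
  | tip _ => t
  | link j i => l j i
  | port j i => p j i

/-- Along segments and arms the potential is interpolated linearly, so only total differences
matter. `S` is the part of the graph available to a walk: unexplored ports outside it impose no
condition, which lets the potential jump there. -/
lemma potential_lipschitz (g : D.Good δ) {c : ℕ → ℝ} {b : Fin (2 * D.N) → ℝ} {t : ℝ}
    {l p : Fin D.N → Fin D.d → ℝ} (S : D.Vertex → Prop)
    (hc : ∀ q, |c (q + 1) - c q| ≤ D.R * D.ε) (hb : ∀ k, |b k - c D.N| ≤ (D.K + 1) * D.α)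
    (ht : t = c D.N) (hl : ∀ j i, |l j i - c j| ≤ D.ε)
    (hp : ∀ j i, S (port j i) → |p j i - l j i| ≤ D.ε)
    (hheavy : ∀ j i, S (port j i) → |p j i - b (D.f j i)| ≤ D.W j) (x y : D.Vertex)
    (hadj : D.graph.Adj x y) (hx : S x) (hy : S y) :
    D.potential c b t l p y - D.potential c b t l p x ≤ D.weight s(x, y) := by
  suffices H : ∀ x y, D.Arc x y → S x → S y →
      |D.potential c b t l p y - D.potential c b t l p x| ≤ D.weight s(x, y) by
    rcases hadj with h | h
    · exact (le_abs_self _).trans (H x y h hx hy)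
    · rw [Sym2.eq_swap]
      have := H y x h hy hx
      rw [abs_sub_comm] at this
      exact (le_abs_self _).trans this
  have hK : (0 : ℝ) < D.K + 1 := by positivity
  have harm : ∀ k, |b k - c D.N| * (1 / (D.K + 1)) ≤ D.α := fun k => by
    rw [mul_one_div, div_le_iff₀ hK, mul_comm]; exact hb k
  have hα : (0 : ℝ) ≤ D.α := D.α.2
  rintro (i | ⟨k, i⟩ | i | ⟨j, i⟩ | ⟨j, i⟩) (i' | ⟨k', i'⟩ | i' | ⟨j', i'⟩ | ⟨j', i'⟩) h hx hy <;>
    simp only [Arc] at h <;> simp only [potential, weight_mk, weightFun]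
  · rw [← h]
    exact abs_interp_succ_sub_le g.R_pos c hc _
  · obtain ⟨h1, h2⟩ := h
    rw [h1, h2, interp_mul g.R_pos]
    have : c D.N + (b k' - c D.N) * (((0 : ℕ) + 1) / (D.K + 1)) - c D.N =
      (b k' - c D.N) * (1 / (D.K + 1)) := by push_cast; ring
    rw [this, abs_mul, abs_of_pos (by positivity : (0 : ℝ) < 1 / (D.K + 1))]
    exact harm k'
  · rw [h.1, interp_mul g.R_pos, ht]
    simp
  · rw [h, interp_mul g.R_pos]
    exact hl _ _
  · obtain ⟨rfl, h2⟩ := h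
    rw [← h2]
    have : c D.N + (b k - c D.N) * (((i.val + 1 : ℕ) + 1) / (D.K + 1)) -
      (c D.N + (b k - c D.N) * ((i.val + 1) / (D.K + 1))) =
      (b k - c D.N) * (1 / (D.K + 1)) := by push_cast; ring
    rw [this, abs_mul, abs_of_pos (by positivity : (0 : ℝ) < 1 / (D.K + 1))]
    exact harm k
  · obtain ⟨rfl, h2⟩ := h
    rw [h2, div_self hK.ne', mul_one, add_sub_cancel]
    exact hheavy _ _ hy
  · simp
  · obtain ⟨rfl, rfl⟩ := h
    exact hp _ _ hy

lemma adj_link {y : D.Vertex} {j : Fin D.N} {i : Fin D.d} :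
    D.graph.Adj y (link j i) ↔ y = D.center j ∨ y = port j i := by
  rcases y with y | y | y | y | y <;> simp [adj_iff, Arc, center, Fin.ext_iff, eq_comm]

lemma adj_port {y : D.Vertex} {j : Fin D.N} {i : Fin D.d} :
    D.graph.Adj y (port j i) ↔ y = link j i ∨ y = D.armEnd (D.f j i) := by
  rcases y with y | y | y | y | y <;> simp [adj_iff, Arc, armEnd, Fin.ext_iff, eq_comm]

/-- The edge between a center and a link is never blocked. -/
lemma not_blockedBy_link (g : D.Good δ) (h : List D.Vertex) (j : Fin D.N) (i : Fin D.d)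
    (u' v' : D.Vertex) : ¬ BlockedBy D.graph D.weight δ h (D.center j) (link j i) u' v' := by
  by_cases hlt : D.graph.Adj u' v' ∧ D.weight s(u', v') < D.ε
  swap
  · exact fun hb => hlt ⟨hb.2.1.1, hb.2.2.1⟩
  obtain ⟨hadj', hlt⟩ := hlt
  -- Edges lighter than `ε` occur only around the hub, on the arms and on the tip. The potential
  -- separates this region from the clusters by `1`, more than `(1 + δ) * ε`.
  let c : ℕ → ℝ := fun q => if q < D.N then 0 else 1
  let φ := D.potential c (fun _ => 1) 1 (fun _ _ => 0) (fun _ _ => 0)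
  have hcN : c D.N = 1 := by simp [c]
  have hcj : ∀ j : Fin D.N, c j = 0 := fun j => by simp [c]
  have hKα : 0 ≤ ((D.K : ℝ) + 1) * D.α := by positivity
  have hlip := potential_lipschitz (c := c) (b := fun _ => 1) (t := 1) (l := fun _ _ => 0)
    (p := fun _ _ => 0) g (fun _ => True)
    (fun q => by
      have h1 := g.le_R_mul
      have h2 := g.δ_pos
      have : |c (q + 1) - c q| ≤ 1 := by
        simp only [c]; split_ifs <;> simp
      linarith)
    (fun k => by rw [hcN]; simpa using hKα) hcN.symm (fun j i => by rw [hcj]; simp)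
    (fun j i _ => by simp) (fun j i _ => by
      have := g.one_le_W j
      simpa using this)
  have hφy : φ (D.center j) = 0 := by
    simp only [φ, potential, center]
    rw [interp_mul g.R_pos, hcj]
  have hφv : φ v' = 1 := by
    have hspine : ∀ i : Fin (D.N * D.R + 1), i.val = D.N * D.R → φ (spine i) = 1 := fun i hi => by
      simp only [φ, potential]
      rw [hi, interp_mul g.R_pos, hcN]
    have hW : ∀ j, ¬ D.W j < D.ε := fun j => not_lt.2 (g.ε_lt_one.le.trans (g.one_le_W j))
    have harm : ∀ k i, φ (arm k i) = 1 := fun k i => by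
      simp only [φ, potential, hcN]; ring
    rcases u' with u' | u' | u' | u' | u' <;> rcases v' with v' | v' | v' | v' | v' <;>
      simp only [weight_mk, weightFun, lt_irrefl] at hlt <;>
      first
      | exact harm _ _
      | rfl
      | (simp [adj_iff, Arc] at hadj'; done)
      | (refine hspine _ ?_; simp [adj_iff, Arc] at hadj'; exact hadj'.1)
      | exact absurd hlt (hW _)
  refine not_blockedBy_of_potential φ (fun a b hab _ _ => hlip a b hab trivial trivial) ?_ ?_
  · rw [hφv, hφy]
    have := g.ε_mul_lt
    simpa [weightFun, center] using this
  · rw [hφv, hφy]; norm_num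

end HubData

namespace HubData

open Vertex

variable {D : HubData} {δ : ℝ}

/-! #### Walks through arms and the tip -/

lemma exploredWalk_arm {h : List D.Vertex} (hz : D.hub ∈ h) (k : Fin (2 * D.N)) (n : ℕ)
    (hn : n < D.K + 1) (hh : ∀ i : Fin (D.K + 1), i.val ≤ n → arm k i ∈ h) :
    ExploredWalk D.graph D.weight h (arm k ⟨n, hn⟩) D.hub ((n + 1) * D.α) := by
  induction n with
  | zero =>
    have := ExploredWalk.of_adj (G := D.graph) (w := D.weight) (hh ⟨0, hn⟩ le_rfl) hz
      (Or.inr (by simp [Arc, hub]) : D.graph.Adj (arm k ⟨0, hn⟩) D.hub)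
    simpa [weightFun, hub] using this
  | succ n ih =>
    have h1 := ih (by omega) (fun i hi => hh i (by omega))
    have h2 := ExploredWalk.of_adj (G := D.graph) (w := D.weight) (hh ⟨n + 1, hn⟩ le_rfl)
      (hh ⟨n, by omega⟩ (by simp))
      (Or.inr (by simp [Arc]) : D.graph.Adj (arm k ⟨n + 1, hn⟩) (arm k ⟨n, by omega⟩))
    convert h2.trans h1 using 1
    simp [weightFun]; ring

lemma exploredWalk_armEnd {h : List D.Vertex} (hz : D.hub ∈ h) (k : Fin (2 * D.N))
    (hh : ∀ i, arm k i ∈ h) :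
    ExploredWalk D.graph D.weight h (D.armEnd k) D.hub ((D.K + 1) * D.α) :=
  exploredWalk_arm hz k D.K (Nat.lt_succ_self _) (fun i _ => hh i)

lemma exploredWalk_tip {h : List D.Vertex} (hz : D.hub ∈ h) (n : ℕ) (hn : n < D.r + 1)
    (hh : ∀ i : Fin (D.r + 1), i.val ≤ n → tip i ∈ h) :
    ExploredWalk D.graph D.weight h D.hub (tip ⟨n, hn⟩) D.α := by
  induction n with
  | zero =>
    have := ExploredWalk.of_adj (G := D.graph) (w := D.weight) hz (hh ⟨0, hn⟩ le_rfl)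
      (Or.inl (by simp [Arc, hub]) : D.graph.Adj D.hub (tip ⟨0, hn⟩))
    simpa [weightFun, hub] using this
  | succ n ih =>
    have h1 := ih (by omega) (fun i hi => hh i (by omega))
    have h2 := ExploredWalk.of_adj (G := D.graph) (w := D.weight) (hh ⟨n, by omega⟩ (by simp))
      (hh ⟨n + 1, hn⟩ le_rfl)
      (Or.inl (by simp [Arc]) : D.graph.Adj (tip ⟨n, by omega⟩) (tip ⟨n + 1, hn⟩))
    simpa [weightFun] using h1.trans h2

/-- A heavy edge is blocked by the next edge of the tip. -/
lemma blockedBy_tip (g : D.Good δ) {h : List D.Vertex} {j : Fin D.N} {i : Fin D.d} {n : ℕ}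
    (hn : n < D.r + 1) (hz : D.hub ∈ h) (harm : ∀ i', arm (D.f j i) i' ∈ h)
    (hport : port j i ∉ h) (htip : ∀ i : Fin (D.r + 1), tip i ∈ h ↔ i.val < n) :
    ∃ u, BlockedBy D.graph D.weight δ h (D.armEnd (D.f j i)) (port j i) u (tip ⟨n, hn⟩) := by
  have hbd : Boundary D.graph h (D.armEnd (D.f j i)) (port j i) :=
    ⟨adj_port.2 (Or.inr rfl), harm _, hport⟩
  have hW := g.one_le_W j
  have hε := g.ε_lt_one
  have hα := g.α_le
  have hαδ := g.α_le_half
  have hlen := g.arm_length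
  have hδ := g.δ_pos
  -- An arm has length `δ / 2`, and the tip is within `α ≤ δ / 2` of the hub, so the total is at
  -- most `δ`.
  have hbound : ∀ L : ℝ≥0, L ≤ D.α →
      (((D.K + 1) * D.α + L : ℝ≥0) : ℝ≥0∞) ≤
        ENNReal.ofReal ((1 + δ) * (D.weight s(D.armEnd (D.f j i), port j i) : ℝ)) := by
    intro L hL
    rw [← ENNReal.ofReal_coe_nnreal]
    refine ENNReal.ofReal_le_ofReal ?_
    have hL' : (L : ℝ) ≤ D.α := by exact_mod_cast hL
    have hW' : (1 : ℝ) ≤ D.W j := by exact_mod_cast hW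
    simp only [weight_mk, weightFun, armEnd]
    push_cast
    nlinarith
  have hend := exploredWalk_armEnd hz (D.f j i) harm
  cases n with
  | zero =>
    refine ⟨D.hub, hbd, ⟨Or.inl (by simp [Arc, hub]), hz, by simp [htip]⟩, ?_, ?_⟩
    · simp only [weight_mk, weightFun, armEnd, hub]
      exact lt_of_le_of_lt hα (lt_of_lt_of_le hε hW)
    · refine (hend.exploredDist_le (Or.inl (by simp [Arc, hub]))).trans (hbound _ ?_)
      simp [weightFun, hub]
  | succ n =>
    have hadj : D.graph.Adj (tip ⟨n, by omega⟩) (tip ⟨n + 1, hn⟩) := Or.inl (by simp [Arc])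
    refine ⟨tip ⟨n, by omega⟩, hbd, ⟨hadj, by simp [htip], by simp [htip]⟩, ?_, ?_⟩
    · simp only [weight_mk, weightFun, armEnd]
      exact lt_of_lt_of_le one_pos hW
    · have htw := exploredWalk_tip hz n (by omega) (fun i hi => (htip i).2 (by omega))
      refine ((hend.trans htw).exploredDist_le hadj).trans ?_
      simp only [weight_mk, weightFun, add_zero]
      exact hbound _ le_rfl

/-! #### The exploration of the ports from the apex -/

/-- All vertices but links and ports are explored, links are explored together with their ports,
and clusters are explored one after the other. -/
structure PortPhase (h : List D.Vertex) : Prop where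
  spine_mem : ∀ i, spine i ∈ h
  arm_mem : ∀ k i, arm k i ∈ h
  tip_mem : ∀ i, tip i ∈ h
  link_mem_iff : ∀ j i, link j i ∈ h ↔ port j i ∈ h
  mono : ∀ j j' i i', j < j' → port j' i' ∈ h → port j i ∈ h

namespace PortPhase

lemma boundary_cases {h : List D.Vertex} (hh : PortPhase h) {y x : D.Vertex}
    (hb : Boundary D.graph h y x) : ∃ j i, port j i ∉ h ∧
      ((y = D.center j ∧ x = link j i) ∨ (y = D.armEnd (D.f j i) ∧ x = port j i)) := by
  obtain ⟨hadj, hy, hx⟩ := hb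
  rcases x with x | ⟨k, x⟩ | x | ⟨j, i⟩ | ⟨j, i⟩
  · exact absurd (hh.spine_mem _) hx
  · exact absurd (hh.arm_mem _ _) hx
  · exact absurd (hh.tip_mem _) hx
  · have hp : port j i ∉ h := fun hp => hx ((hh.link_mem_iff j i).2 hp)
    refine ⟨j, i, hp, Or.inl ⟨(adj_link.1 hadj).resolve_right ?_, rfl⟩⟩
    rintro rfl; exact hp hy
  · refine ⟨j, i, hx, Or.inr ⟨(adj_port.1 hadj).resolve_left ?_, rfl⟩⟩
    rintro rfl; exact hx ((hh.link_mem_iff j i).1 hy)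

/-- Heavy edges of a later cluster are blocked as long as an earlier cluster is not finished. -/
lemma blocked_of_lt (g : D.Good δ) {h : List D.Vertex} (hh : PortPhase h) {j j' : Fin D.N}
    {i i' : Fin D.d} (hj : j < j') (hi : port j i ∉ h) (hi' : port j' i' ∉ h) :
    BlockedBy D.graph D.weight δ h (D.armEnd (D.f j' i')) (port j' i')
      (D.armEnd (D.f j i)) (port j i) := by
  have hadj : ∀ j i, D.graph.Adj (D.armEnd (D.f j i)) (port j i) := fun j i =>
    adj_port.2 (Or.inr rfl)
  have hW := g.W_strictMono hj
  refine ⟨⟨hadj _ _, hh.arm_mem _ _, hi'⟩, ⟨hadj _ _, hh.arm_mem _ _, hi⟩, ?_, ?_⟩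
  · simpa [weightFun, armEnd] using hW
  · have h1 := exploredWalk_armEnd (hh.spine_mem (Fin.last _)) (D.f j' i') (hh.arm_mem _)
    have h2 := exploredWalk_armEnd (hh.spine_mem (Fin.last _)) (D.f j i) (hh.arm_mem _)
    refine ((h1.trans h2.symm).exploredDist_le (hadj j i)).trans ?_
    rw [← ENNReal.ofReal_coe_nnreal]
    refine ENNReal.ofReal_le_ofReal ?_
    have hlen := g.arm_length
    have hδ := g.δ_pos
    have hW1 : (1 : ℝ) ≤ D.W j' := by exact_mod_cast g.one_le_W j'
    have hW2 : (D.W j : ℝ) ≤ D.W j' := by exact_mod_cast hW.le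
    simp only [weight_mk, weightFun, armEnd]
    push_cast
    nlinarith

/-- Heavy edges of the first unfinished cluster are not blocked. -/
lemma not_blocked (g : D.Good δ) {h : List D.Vertex} (hh : PortPhase h) {j₀ : Fin D.N}
    {i₀ : Fin D.d} (hi₀ : port j₀ i₀ ∉ h) (hmin : ∀ j i, j < j₀ → port j i ∈ h) :
    ¬ ∃ u' v', BlockedBy D.graph D.weight δ h (D.armEnd (D.f j₀ i₀)) (port j₀ i₀) u' v' := by
  rintro ⟨u', v', hb⟩
  obtain ⟨j₁, i₁, hp₁, hcase⟩ := hh.boundary_cases hb.2.1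
  have hj₁ : j₀ ≤ j₁ := by
    by_contra hcon
    exact hp₁ (hmin j₁ i₁ (not_le.1 hcon))
  obtain ⟨a, ha₀, ha, hasmall, halarge⟩ := g.sparse j₀ i₀
  rcases hcase with ⟨rfl, rfl⟩ | ⟨rfl, rfl⟩
  swap
  · have := hb.2.2.1
    simp only [weight_mk, weightFun, armEnd] at this
    exact absurd (g.W_strictMono.monotone hj₁) (not_le.2 this)
  have hδ := g.δ_pos
  have hW1 : (1 : ℝ) ≤ D.W j₀ := by exact_mod_cast g.one_le_W j₀
  have hW2 : (D.W j₀ : ℝ) ≤ 2 := by exact_mod_cast g.W_le_two j₀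
  have hWone : ∀ j, (1 : ℝ) ≤ D.W j := fun j => by exact_mod_cast g.one_le_W j
  have hε0 : (0 : ℝ) ≤ D.ε := D.ε.2
  -- The arms of an earlier cluster have values within `2` of each other, so its center can be given
  -- a value within `1` of all of them. Heavy edges weigh at least `1`.
  have hmid : ∀ j : Fin D.N, ∃ m : ℝ, 0 ≤ m ∧ m ≤ δ + 2 ∧
      (j < j₀ → ∀ i, |m - a (D.f j i)| ≤ 1) := by
    intro j
    by_cases hj : j < j₀
    · obtain ⟨i', -, hi'⟩ := Finset.exists_min_image Finset.univ (fun i => a (D.f j i))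
        ⟨⟨0, g.d_pos⟩, Finset.mem_univ _⟩
      refine ⟨a (D.f j i') + 1, by linarith [(ha (D.f j i')).1],
        by linarith [(ha (D.f j i')).2], fun _ i => ?_⟩
      have h1 := hi' i (Finset.mem_univ _)
      have h2 := (abs_le.1 (hasmall j hj i' i)).1
      rw [abs_le]
      constructor <;> linarith
    · exact ⟨0, le_rfl, by linarith, fun h => absurd h hj⟩
  choose m hm0 hm2 hm using hmid
  -- Unfinished clusters lie at `δ + W j₀`: explored ports of cluster `j₀` hang on arms of value
  -- `δ`, by sparsity. The hub is at `δ / 2`. Consecutive centers differ by at most `δ + 2 ≤ R * ε`.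
  let c : ℕ → ℝ := fun q =>
    if hq : q < D.N then (if (⟨q, hq⟩ : Fin D.N) < j₀ then m ⟨q, hq⟩ else δ + D.W j₀) else δ / 2
  have hc0 : ∀ q, 0 ≤ c q ∧ c q ≤ δ + 2 := by
    intro q
    simp only [c]
    split_ifs
    · exact ⟨hm0 _, hm2 _⟩
    · constructor <;> linarith
    · constructor <;> linarith
  have hcN : c D.N = δ / 2 := by simp [c]
  have hclt : ∀ j : Fin D.N, j < j₀ → c j = m j := fun j hj => by simp [c, hj]
  have hcge : ∀ j : Fin D.N, j₀ ≤ j → c j = δ + D.W j₀ := fun j hj => by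
    simp [c, not_lt.2 hj]
  classical
  -- A link whose port is unexplored can only be entered from its center, so it gains a further `ε`.
  -- This gain exceeds `δ * (W j₀ - 1)`, the excess of `(1 + δ) * W j₀` over `δ + W j₀`.
  let l : Fin D.N → Fin D.d → ℝ := fun j i => if port j i ∈ h then c j else c j + D.ε
  let φ := D.potential c a (δ / 2) l (fun j _ => c j)
  have hlip := potential_lipschitz (c := c) (b := a) (t := δ / 2) (l := l)
    (p := fun j _ => c j) g (fun x => x ∈ h ∨ x = link j₁ i₁)
    (fun q => by
      have h1 := g.le_R_mul
      rw [abs_le]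
      constructor <;> linarith [(hc0 q).1, (hc0 q).2, (hc0 (q + 1)).1, (hc0 (q + 1)).2])
    (fun k => by
      have h1 := g.arm_length
      rw [hcN, abs_le]
      constructor <;> linarith [(ha k).1, (ha k).2])
    hcN.symm
    (fun j i => by
      simp only [l]
      split_ifs <;> simp)
    (fun j i hS => by
      have hp : port j i ∈ h := by simpa using hS
      simp [l, hp])
    (fun j i hS => by
      have hp : port j i ∈ h := by simpa using hS
      rcases lt_trichotomy j j₀ with hj | rfl | hj
      · rw [hclt j hj]
        exact (hm j hj i).trans (hWone j)
      · have hne : i ≠ i₀ := by rintro rfl; exact hi₀ hp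
        rw [hcge j le_rfl, halarge i hne]
        simp
      · exact absurd (hh.mono j₀ j i₀ i hj hp) hi₀)
  have hK : (D.K : ℝ) + 1 ≠ 0 := by positivity
  have hφy : φ (D.armEnd (D.f j₀ i₀)) = 0 := by
    simp only [φ, potential, armEnd, Fin.val_last]
    rw [div_self hK, ha₀]; ring
  have hφv : φ (link j₁ i₁) = δ + D.W j₀ + D.ε := by
    simp only [φ, potential, l, if_neg hp₁]
    rw [hcge j₁ hj₁]
  refine not_blockedBy_of_potential φ hlip ?_ ?_ hb
  · rw [hφv, hφy]
    have := g.W_close j₀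
    simp only [weight_mk, weightFun, armEnd]
    linarith
  · rw [hφv, hφy]
    linarith

open Classical in
/-- The number of explored ports. -/
noncomputable def portCount (h : List D.Vertex) : ℕ :=
  (Finset.univ.filter fun t : Fin D.N × Fin D.d => port t.1 t.2 ∈ h).card

lemma portCount_le {h : List D.Vertex} (j : Fin D.N) (i : Fin D.d) :
    portCount (link j i :: port j i :: h) ≤ portCount h + 1 := by
  classical
  unfold portCount
  refine (Finset.card_le_card (t := insert (j, i) (Finset.univ.filter
    fun t : Fin D.N × Fin D.d => port t.1 t.2 ∈ h)) ?_).trans (Finset.card_insert_le _ _)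
  rintro ⟨j', i'⟩
  simp

lemma insert {h : List D.Vertex} (hh : PortPhase h) {j : Fin D.N} {i : Fin D.d}
    (hmin : ∀ j' i', j' < j → port j' i' ∈ h) : PortPhase (link j i :: port j i :: h) where
  spine_mem _ := by simp [hh.spine_mem]
  arm_mem _ _ := by simp [hh.arm_mem]
  tip_mem _ := by simp [hh.tip_mem]
  link_mem_iff j' i' := by simp [hh.link_mem_iff]
  mono j₁ j₂ i₁ i₂ hlt hmem := by
    simp only [List.mem_cons, reduceCtorEq, false_or, port.injEq] at hmem ⊢
    rcases hmem with ⟨rfl, rfl⟩ | hmem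
    · exact Or.inr (hmin j₁ i₁ hlt)
    · exact Or.inr (hh.mono _ _ _ _ hlt hmem)

/-- In this phase, calls at vertices off the spine and the arms explore new ports only by heavy
edges. -/
lemma exists_exec (g : D.Good δ) (v : D.Vertex) (hspine : ∀ i, v ≠ spine i)
    (harm : ∀ k i, v ≠ arm k i) (h : List D.Vertex) (hh : PortPhase h) :
    ∃ h' c, BlockingExec D.graph D.weight δ v h h' c ∧ PortPhase h' ∧
      (portCount h' : ℝ≥0∞) ≤ portCount h + c := by
  classical
  induction hn : (Finset.univ.filter (fun z => z ∉ h)).card using Nat.strong_induction_on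
    generalizing v h with
  | _ n ih =>
    by_cases hv : ∃ y x, Candidate D.graph D.weight δ h v y x
    swap
    · exact ⟨h, 0, .done v h hv, hh, by simp⟩
    obtain ⟨y, x, hc⟩ := hv
    obtain ⟨j, i, hp, ⟨rfl, rfl⟩ | ⟨rfl, rfl⟩⟩ := hh.boundary_cases hc.1
    · rcases hc.2.2 with h1 | ⟨h', -, u, hb⟩
      · exact absurd h1.symm (hspine _)
      · exact absurd hb (not_blockedBy_link g _ _ _ _ _)
    -- An unblocked heavy edge belongs to the first unfinished cluster, which preserves the order in
    -- which clusters are explored.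
    have hmin : ∀ j' i', j' < j → port j' i' ∈ h := by
      intro j' i' hj'
      by_contra hcon
      exact hc.2.1 ⟨_, _, hh.blocked_of_lt g hj' hcon hp⟩
    have hl : link j i ∉ h := fun hl => hp ((hh.link_mem_iff j i).1 hl)
    -- With spine, arms and tip explored, no boundary edge is lighter than `ε`. Hence the link can
    -- be explored right after its port, restoring `link_mem_iff`.
    have hc' : Candidate D.graph D.weight δ (port j i :: h) (port j i) (port j i) (link j i) := by
      refine ⟨⟨adj_link.2 (Or.inr rfl), by simp, by simp [hl]⟩, ?_, Or.inl rfl⟩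
      rintro ⟨u', v', -, hb', hlt, -⟩
      have hv' : v' ∉ h := fun hv' => hb'.2.2 (by simp [hv'])
      simp only [weight_mk, weightFun] at hlt
      have hWε : ∀ j, D.ε ≤ D.W j := fun j => g.ε_lt_one.le.trans (g.one_le_W j)
      rcases v' with v' | ⟨k, v'⟩ | v' | ⟨j', i'⟩ | ⟨j', i'⟩
      · exact hv' (hh.spine_mem _)
      · exact hv' (hh.arm_mem _ _)
      · exact hv' (hh.tip_mem _)
      · rcases adj_link.1 hb'.1 with rfl | rfl <;> simp [center] at hlt
      · rcases adj_port.1 hb'.1 with rfl | rfl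
        · simp at hlt
        · exact absurd hlt (not_lt.2 (hWε _))
    have hh1 := hh.insert (i := i) hmin
    have hcard0 : (Finset.univ.filter (fun z => z ∉ link j i :: port j i :: h)).card < n :=
      hn ▸ card_unexplored_lt hp ⟨[link j i], rfl⟩
    obtain ⟨h₁, c₁, e₁, hh₁, hC₁⟩ := ih _ hcard0 (link j i) (by simp) (by simp) _ hh1 rfl
    have hcard1 : (Finset.univ.filter (fun z => z ∉ h₁)).card < n :=
      hn ▸ card_unexplored_lt hp ((List.suffix_cons _ _).trans e₁.suffix)
    obtain ⟨h₂, c₂, e₂, hh₂, hC₂⟩ := ih _ hcard1 (port j i) (by simp) (by simp) _ hh₁ rfl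
    have hcard2 : (Finset.univ.filter (fun z => z ∉ h₂)).card < n :=
      hn ▸ card_unexplored_lt hp (((List.suffix_cons _ _).trans e₁.suffix).trans e₂.suffix)
    obtain ⟨h₃, c₃, e₃, hh₃, hC₃⟩ := ih _ hcard2 v hspine harm _ hh₂ rfl
    refine ⟨_, _, .step _ _ _ _ _ _ _ _ hc (.step _ _ _ _ _ _ _ _ hc' e₁ e₂) e₃, hh₃, ?_⟩
    have h1 : (portCount (link j i :: port j i :: h) : ℝ≥0∞) ≤ portCount h + 1 := by
      exact_mod_cast portCount_le j i
    have h2 : (1 : ℝ≥0∞) ≤ D.weight s(D.armEnd (D.f j i), port j i) := by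
      simp only [weight_mk, weightFun, armEnd]
      exact_mod_cast g.one_le_W j
    calc (portCount h₃ : ℝ≥0∞) ≤ portCount h + 1 + c₁ + c₂ + c₃ := by
          refine hC₃.trans ?_
          gcongr
          refine hC₂.trans ?_
          gcongr
          refine hC₁.trans ?_
          gcongr
      -- The zeros stand for the discarded lengths of walks and of the edge to the link; the `1` is
      -- the heavy edge paying for the new port.
      _ = portCount h + (0 + 1 + (0 + 0 + c₁ + 0 + c₂) + 0 + c₃) := by ring
      _ ≤ _ := by gcongr <;> exact zero_le

/-- From the apex, all ports are explored by heavy edges. -/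
lemma canCost_apex (g : D.Good δ) {h : List D.Vertex} (hh : PortPhase h)
    (hport : ∀ j i, port j i ∉ h)
    (hb : ∃ h₀, h₀ <:+ h ∧ ∀ j i, ∃ u, BlockedBy D.graph D.weight δ h₀ (D.armEnd (D.f j i))
      (port j i) u D.apex) :
    CanCost D.graph D.weight δ D.apex h (ENNReal.ofReal (D.N * D.d)) := by
  classical
  obtain ⟨h', c, e, hh', hC⟩ := exists_exec g D.apex (by simp [apex]) (by simp [apex]) h hh
  refine ⟨h', c, e, ?_⟩
  obtain ⟨h₀, hs, hb⟩ := hb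
  -- Otherwise a heavy edge of the first unfinished cluster would be unblocked, and it was once
  -- blocked by the edge to the apex, so the loop could not have ended.
  have hall : ∀ j i, port j i ∈ h' := by
    by_contra hcon
    push Not at hcon
    obtain ⟨j₀, hj₀, hmin⟩ := Finset.exists_min_image
      (Finset.univ.filter fun j => ∃ i, port j i ∉ h') id (by
        obtain ⟨j, i, hi⟩ := hcon
        exact ⟨j, by simp; exact ⟨i, hi⟩⟩)
    simp only [Finset.mem_filter, Finset.mem_univ, true_and, id] at hj₀ hmin
    obtain ⟨i₀, hi₀⟩ := hj₀
    refine e.no_candidate ⟨D.armEnd (D.f j₀ i₀), port j₀ i₀,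
      ⟨adj_port.2 (Or.inr rfl), hh'.arm_mem _ _, hi₀⟩, hh'.not_blocked g hi₀ ?_,
      Or.inr ⟨h₀, hs.trans e.suffix, hb j₀ i₀⟩⟩
    intro j i hj
    by_contra hcon
    exact absurd (hmin j ⟨i, hcon⟩) (not_le.2 hj)
  have h0 : portCount h = 0 := by
    simp [portCount, hport]
  have h1 : portCount h' = D.N * D.d := by
    simp [portCount, hall]
  rw [h0, h1] at hC
  rw [← Nat.cast_mul, ENNReal.ofReal_natCast]
  simpa using hC

end PortPhase

end HubData

namespace HubData

open Vertex

variable {D : HubData} {δ : ℝ}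

lemma adj_arm {y : D.Vertex} {k : Fin (2 * D.N)} {i : Fin (D.K + 1)} (h : D.graph.Adj y (arm k i)) :
    (y = D.hub ∧ i.val = 0) ∨ (∃ i' : Fin (D.K + 1), y = arm k i' ∧ i'.val + 1 = i.val) ∨
      (∃ i' : Fin (D.K + 1), y = arm k i' ∧ i.val + 1 = i'.val) ∨ ∃ j i, y = port j i := by
  rcases y with y | ⟨k', y⟩ | y | ⟨j, y⟩ | ⟨j, y⟩ <;> rcases h with h | h <;> simp only [Arc] at h
  · exact Or.inl ⟨congrArg spine (Fin.ext h.1), h.2⟩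
  · exact Or.inr (Or.inl ⟨y, by rw [h.1], h.2⟩)
  · exact Or.inr (Or.inr (Or.inl ⟨y, by rw [h.1], h.2⟩))
  · exact Or.inr (Or.inr (Or.inr ⟨j, y, rfl⟩))

lemma adj_tip {y : D.Vertex} {i : Fin (D.r + 1)} (h : D.graph.Adj y (tip i)) :
    (y = D.hub ∧ i.val = 0) ∨ ∃ i' : Fin (D.r + 1), y = tip i' := by
  rcases y with y | ⟨k', y⟩ | y | ⟨j, y⟩ | ⟨j, y⟩ <;> rcases h with h | h <;> simp only [Arc] at h
  · exact Or.inl ⟨congrArg spine (Fin.ext h.1), h.2⟩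
  · exact Or.inr ⟨y, rfl⟩
  · exact Or.inr ⟨y, rfl⟩

/-- Only the inner edges of the tip weigh less than `α`. Hence edges of weight `α` are never blocked
before the tip is entered. -/
lemma α_le_weight (g : D.Good δ) {x y : D.Vertex} (hadj : D.graph.Adj x y)
    (hx : ∀ i, x ≠ tip i) : D.α ≤ D.weight s(x, y) := by
  have h1 := g.α_le
  have h2 : ∀ j, D.α ≤ D.W j := fun j => (h1.trans g.ε_lt_one.le).trans (g.one_le_W j)
  rcases x with x | x | x | x | x <;> rcases y with y | y | y | y | y <;>
    simp [adj_iff, Arc] at hadj <;> (simp [weightFun, h1, h2]; try simp at hx)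

/-! #### The tip -/

/-- The spine, the arms and the first `n` vertices of the tip are explored. -/
structure TipPhase (n : ℕ) (h : List D.Vertex) : Prop where
  spine_mem : ∀ i, spine i ∈ h
  arm_mem : ∀ k i, arm k i ∈ h
  tip_mem_iff : ∀ i : Fin (D.r + 1), tip i ∈ h ↔ i.val < n
  link_notMem : ∀ j i, link j i ∉ h
  port_notMem : ∀ j i, port j i ∉ h

lemma TipPhase.cons {n : ℕ} {h : List D.Vertex} (hh : TipPhase n h) (hn : n < D.r + 1) :
    TipPhase (n + 1) (tip ⟨n, hn⟩ :: h) where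
  spine_mem _ := by simp [hh.spine_mem]
  arm_mem _ _ := by simp [hh.arm_mem]
  tip_mem_iff i := by
    simp only [List.mem_cons, tip.injEq, hh.tip_mem_iff, Fin.ext_iff]
    omega
  link_notMem _ _ := by simp [hh.link_notMem]
  port_notMem _ _ := by simp [hh.port_notMem]

/-- Inner tip edges have weight `0`, so nothing blocks them. Just before the apex is explored, the
edge to it blocks every heavy edge. -/
lemma canCost_tip (g : D.Good δ) (n : ℕ) (hn : n < D.r + 1) (h : List D.Vertex)
    (hh : TipPhase n h) :
    CanCost D.graph D.weight δ (tip ⟨n, hn⟩) (tip ⟨n, hn⟩ :: h) (ENNReal.ofReal (D.N * D.d)) := by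
  induction hr : D.r - n generalizing n h with
  | zero =>
    obtain rfl : n = D.r := by omega
    have hh' := hh.cons hn
    refine PortPhase.canCost_apex g ⟨hh'.spine_mem, hh'.arm_mem, ?_, ?_, ?_⟩ hh'.port_notMem
      ⟨h, List.suffix_cons _ _, fun j i => blockedBy_tip g hn (hh.spine_mem _) (hh.arm_mem _)
        (hh.port_notMem _ _) hh.tip_mem_iff⟩
    · intro i; rw [hh'.tip_mem_iff]; exact i.2
    · intro j i; simp [hh'.link_notMem, hh'.port_notMem]
    · intro j j' i i' _ hm; exact absurd hm (hh'.port_notMem _ _)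
  | succ s ih =>
    have hn' : n + 1 < D.r + 1 := by omega
    have hh' := hh.cons hn
    refine CanCost.of_call (y := tip ⟨n, hn⟩) (x := tip ⟨n + 1, hn'⟩) ⟨⟨Or.inl (by simp [Arc]),
      by simp, by rw [hh'.tip_mem_iff]; simp⟩, ?_, Or.inl rfl⟩ (ih (n + 1) hn' _ hh' (by omega))
    rintro ⟨u', v', -, -, hlt, -⟩
    simp [weightFun] at hlt

/-! #### The arms -/

/-- The spine and initial parts of the arms are explored. -/
structure ArmPhase (h : List D.Vertex) : Prop where
  spine_mem : ∀ i, spine i ∈ h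
  arm_mem : ∀ k (i i' : Fin (D.K + 1)), i' ≤ i → arm k i ∈ h → arm k i' ∈ h
  tip_notMem : ∀ i, tip i ∉ h
  link_notMem : ∀ j i, link j i ∉ h
  port_notMem : ∀ j i, port j i ∉ h

namespace ArmPhase

lemma not_blockedBy (g : D.Good δ) {h h' : List D.Vertex} (hh : ArmPhase h) (hs : h' <:+ h)
    {y x : D.Vertex} (hw : D.weight s(y, x) = D.α) (u v : D.Vertex) :
    ¬ BlockedBy D.graph D.weight δ h' y x u v := by
  rintro ⟨-, hb, hlt, -⟩
  rw [hw] at hlt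
  refine absurd hlt (not_lt.2 (α_le_weight g hb.1 ?_))
  rintro i rfl
  exact hh.tip_notMem i (hs.subset hb.2.1)

/-- Inside an arm, only the next vertex of the arm can be explored. -/
lemma not_candidate (g : D.Good δ) {h : List D.Vertex} (hh : ArmPhase h) {k : Fin (2 * D.N)}
    {i : Fin (D.K + 1)} (hi : ∀ i', arm k i' ∈ h) :
    ¬ ∃ y x, Candidate D.graph D.weight δ h (arm k i) y x := by
  rintro ⟨y, x, hb, hnb, hor⟩
  obtain ⟨hadj, hy, hx⟩ := hb
  have hα : D.weight s(y, x) = D.α → y ≠ arm k i → False := by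
    intro hw hne
    rcases hor with h1 | ⟨h', hs, u, hbl⟩
    · exact hne h1
    · exact hh.not_blockedBy g hs hw _ _ hbl
  rcases x with x | ⟨k', x⟩ | x | ⟨j, x⟩ | ⟨j, x⟩
  · exact hx (hh.spine_mem _)
  · rcases adj_arm hadj with ⟨rfl, -⟩ | ⟨i', rfl, -⟩ | ⟨i', rfl, h1⟩ | ⟨j, i', rfl⟩
    · exact hα rfl (by simp [hub])
    · refine hα rfl fun h1 => ?_
      injection h1 with h1 h2
      subst h1
      exact hx (hi x)
    · exact hx (hh.arm_mem k' i' x (by rw [Fin.le_def]; omega) hy)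
    · exact hh.port_notMem _ _ hy
  · rcases adj_tip hadj with ⟨rfl, -⟩ | ⟨i', rfl⟩
    · exact hα rfl (by simp [hub])
    · exact hh.tip_notMem _ hy
  · rcases adj_link.1 hadj with rfl | rfl
    · rcases hor with h1 | ⟨h', -, u, hbl⟩
      · simp [center] at h1
      · exact not_blockedBy_link g _ _ _ _ _ hbl
    · exact hh.port_notMem _ _ hy
  · rcases adj_port.1 hadj with rfl | rfl
    · exact hh.link_notMem _ _ hy
    · obtain ⟨u, hbl⟩ := blockedBy_tip g (n := 0) (by omega) (hh.spine_mem (Fin.last _))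
        (fun i' => hh.arm_mem _ _ i' (Fin.le_last i') hy) hx (fun i' => by simp [hh.tip_notMem])
      exact hnb ⟨_, _, hbl⟩

lemma cons {h : List D.Vertex} (hh : ArmPhase h) {k : Fin (2 * D.N)} {i : Fin (D.K + 1)}
    (hi : ∀ i' < i, arm k i' ∈ h) : ArmPhase (arm k i :: h) where
  spine_mem _ := by simp [hh.spine_mem]
  arm_mem k' i₁ i₂ hle hm := by
    simp only [List.mem_cons, arm.injEq] at hm ⊢
    rcases hm with ⟨rfl, rfl⟩ | hm
    · rcases hle.eq_or_lt with rfl | hlt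
      · exact Or.inl ⟨rfl, rfl⟩
      · exact Or.inr (hi _ hlt)
    · exact Or.inr (hh.arm_mem _ _ _ hle hm)
  tip_notMem _ := by simp [hh.tip_notMem]
  link_notMem _ _ := by simp [hh.link_notMem]
  port_notMem _ _ := by simp [hh.port_notMem]

/-- A call inside an arm explores exactly the rest of the arm. -/
lemma exists_exec (g : D.Good δ) (k : Fin (2 * D.N)) (n : ℕ) (hn : n < D.K + 1)
    (h : List D.Vertex) (hh : ArmPhase h)
    (hmem : ∀ i : Fin (D.K + 1), arm k i ∈ h ↔ i.val ≤ n) :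
    ∃ h' c, BlockingExec D.graph D.weight δ (arm k ⟨n, hn⟩) h h' c ∧ ArmPhase h' ∧
      ∀ k' i, arm k' i ∈ h' ↔ arm k' i ∈ h ∨ k' = k := by
  induction hr : D.K - n generalizing n h with
  | zero =>
    have hall : ∀ i, arm k i ∈ h := fun i => (hmem i).2 (by omega)
    refine ⟨h, 0, .done _ _ (hh.not_candidate g hall), hh, fun k' i => ?_⟩
    constructor
    · exact Or.inl
    · rintro (h1 | rfl)
      · exact h1
      · exact hall i
  | succ s ih =>
    have hn' : n + 1 < D.K + 1 := by omega
    have hx : arm k ⟨n + 1, hn'⟩ ∉ h := by rw [hmem]; simp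
    have hc : Candidate D.graph D.weight δ h (arm k ⟨n, hn⟩) (arm k ⟨n, hn⟩)
        (arm k ⟨n + 1, hn'⟩) := by
      refine ⟨⟨Or.inl (by simp [Arc]), (hmem _).2 le_rfl, hx⟩, ?_, Or.inl rfl⟩
      rintro ⟨u', v', hbl⟩
      exact hh.not_blockedBy g (List.suffix_refl h) rfl _ _ hbl
    obtain ⟨h', c, e, hh', hm'⟩ := ih (n + 1) hn' (arm k ⟨n + 1, hn'⟩ :: h)
      (hh.cons fun i' hi' => (hmem i').2 (Nat.lt_succ_iff.1 hi')) (fun i => by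
        simp only [List.mem_cons, arm.injEq, true_and, hmem, Fin.ext_iff]
        omega) (by omega)
    refine ⟨h', _, .step _ _ _ _ _ _ _ _ hc e
      (.done _ _ (hh'.not_candidate g fun i' => (hm' _ _).2 (Or.inr rfl))), hh', fun k' i => ?_⟩
    rw [hm']
    simp only [List.mem_cons, arm.injEq]
    tauto

-- The adversary uses the freedom of choice at the hub: all arms are explored before the tip, so
-- that every heavy edge is a boundary edge when the tip blocks it.
open Classical in
lemma canCost_hub (g : D.Good δ) (n : ℕ) (h : List D.Vertex) (hh : ArmPhase h)
    (hmem : ∀ k i, arm k i ∈ h → ∀ i', arm k i' ∈ h)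
    (hn : (Finset.univ.filter fun k : Fin (2 * D.N) => arm k 0 ∉ h).card = n) :
    CanCost D.graph D.weight δ D.hub h (ENNReal.ofReal (D.N * D.d)) := by
  induction n using Nat.strong_induction_on generalizing h with
  | _ n ih =>
    by_cases hall : ∀ k, arm k 0 ∈ h
    · refine CanCost.of_call (y := D.hub) (x := tip ⟨0, Nat.succ_pos _⟩)
        ⟨⟨Or.inl (by simp [Arc, hub]), hh.spine_mem _, hh.tip_notMem _⟩, ?_, Or.inl rfl⟩
        (canCost_tip g 0 _ h ⟨hh.spine_mem, fun k i => hmem k 0 (hall k) i, fun i => ?_,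
          hh.link_notMem, hh.port_notMem⟩)
      · rintro ⟨u', v', hbl⟩
        exact hh.not_blockedBy g (List.suffix_refl h) rfl _ _ hbl
      · simp [hh.tip_notMem]
    · push Not at hall
      obtain ⟨k, hk⟩ := hall
      have hk' : ∀ i, arm k i ∉ h := fun i hi => hk (hmem k i hi 0)
      have hc : Candidate D.graph D.weight δ h D.hub D.hub (arm k 0) := by
        refine ⟨⟨Or.inl (by simp [Arc, hub]), hh.spine_mem _, hk⟩, ?_, Or.inl rfl⟩
        rintro ⟨u', v', hbl⟩
        exact hh.not_blockedBy g (List.suffix_refl h) rfl _ _ hbl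
      obtain ⟨h', c, e, hh', hm'⟩ := exists_exec g k 0 (Nat.succ_pos _) (arm k 0 :: h)
        (hh.cons fun i' hi' => absurd hi' (Fin.not_lt_zero i')) (fun i => by
          simp only [List.mem_cons, arm.injEq, true_and, hk', or_false, Fin.ext_iff]
          simp)
      refine CanCost.of_loop hc e (ih _ ?_ h' hh' ?_ rfl)
      · rw [← hn]
        apply Finset.card_lt_card
        refine ⟨fun k' => ?_, fun hs => ?_⟩
        · simp only [Finset.mem_filter, Finset.mem_univ, true_and, hm', List.mem_cons]
          tauto
        · have := hs (show k ∈ _ by simpa using hk)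
          simp [hm'] at this
      · intro k' i hi i'
        simp only [hm', List.mem_cons, arm.injEq] at hi ⊢
        rcases hi with (⟨rfl, rfl⟩ | hi) | rfl
        · exact Or.inr rfl
        · exact Or.inl (Or.inr (hmem _ _ hi _))
        · exact Or.inr rfl

end ArmPhase

/-! #### The spine -/

/-- Until the hub is reached all boundary edges have weight `ε`, so none is blocked and the agent
may ignore the links and walk to the hub. -/
lemma canCost_spine (g : D.Good δ) (n : ℕ) (hn : n < D.N * D.R + 1) (h : List D.Vertex)
    (hh : ∀ x, x ∈ h ↔ ∃ i : Fin (D.N * D.R + 1), i.val ≤ n ∧ x = spine i) :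
    CanCost D.graph D.weight δ (spine ⟨n, hn⟩) h (ENNReal.ofReal (D.N * D.d)) := by
  induction hr : D.N * D.R - n generalizing n h with
  | zero =>
    obtain rfl : n = D.N * D.R := by omega
    refine ArmPhase.canCost_hub g _ h ⟨fun i => (hh _).2 ⟨i, by omega, rfl⟩, ?_, ?_, ?_, ?_⟩ ?_ rfl
    all_goals simp [hh]
  | succ s ih =>
    have hn' : n + 1 < D.N * D.R + 1 := by omega
    refine CanCost.of_call (y := spine ⟨n, hn⟩) (x := spine ⟨n + 1, hn'⟩)
      ⟨⟨Or.inl (by simp [Arc]), (hh _).2 ⟨_, le_rfl, rfl⟩, ?_⟩, ?_, Or.inl rfl⟩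
      (ih (n + 1) hn' _ ?_ (by omega))
    · rw [hh]
      rintro ⟨i, hi, h1⟩
      injection h1 with h1
      rw [← h1] at hi
      simp at hi
    · rintro ⟨u', v', -, ⟨hadj, hu, hv⟩, hlt, -⟩
      obtain ⟨i, hi, rfl⟩ := (hh _).1 hu
      have hi' : i.val ≠ D.N * D.R := by omega
      rcases v' with v' | v' | v' | v' | v' <;> simp [weightFun] at hlt <;>
        simp [adj_iff, Arc, hi'] at hadj
    · intro x
      rw [List.mem_cons, hh]
      constructor
      · rintro (rfl | ⟨j, hj, rfl⟩)
        · exact ⟨_, le_rfl, rfl⟩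
        · exact ⟨j, hj.trans (Nat.le_succ n), rfl⟩
      · rintro ⟨j, hj, rfl⟩
        rcases Nat.lt_or_ge n j.val with h1 | h1
        · left; congr 1; ext; exact le_antisymm hj h1
        · exact Or.inr ⟨j, h1, rfl⟩

/-! #### The offline optimum -/

/-- The spanning tree of cheap edges, by parents. -/
def parent (D : HubData) : D.Vertex → D.Vertex
  | spine i => spine ⟨i.val - 1, by omega⟩
  | arm k i => if i.val = 0 then D.hub else arm k ⟨i.val - 1, by omega⟩
  | tip i => if i.val = 0 then D.hub else tip ⟨i.val - 1, by omega⟩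
  | link j _ => D.center j
  | port j i => link j i

/-- A rank function that increases away from the root of the spanning tree. -/
def rank (D : HubData) : D.Vertex → ℕ
  | spine i => i.val
  | arm _ i => D.N * D.R + 1 + i.val
  | tip i => D.N * D.R + 1 + i.val
  | link _ _ => D.N * D.R + 1
  | port _ _ => D.N * D.R + 2

/-- The weights of the edges to the parents. -/
def parentWeight (D : HubData) : D.Vertex → ℝ≥0
  | spine i => if i = 0 then 0 else D.ε
  | arm _ _ => D.α
  | tip i => if i = 0 then D.α else 0
  | link _ _ => D.ε
  | port _ _ => D.ε

lemma exists_closed_walk (D : HubData) :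
    ∃ (s : D.Vertex) (p : D.graph.Walk s s), (∀ z, z ∈ p.support) ∧
      (walkWeight D.graph D.weight p : ℝ) ≤
        2 * (D.N * D.R * D.ε + 2 * D.N * ((D.K + 1) * D.α) + D.α + 2 * (D.N * D.d * D.ε)) := by
  obtain ⟨p, h1, h2⟩ := exists_closed_walk_of_parent (G := D.graph) (w := D.weight)
    (spine 0) D.parent D.rank D.parentWeight (by
      rintro (i | ⟨k, i⟩ | i | ⟨j, i⟩ | ⟨j, i⟩) hi
      · have h' : i ≠ 0 := fun h => hi (by rw [h])
        have h'' : i.val ≠ 0 := fun h => h' (Fin.ext h)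
        refine ⟨Or.inl ?_, ?_, ?_⟩
        · simp only [parent, Arc]; omega
        · simp only [parent, rank]; omega
        · simp [parent, parentWeight, weightFun, h']
      · by_cases h' : i.val = 0
        · refine ⟨Or.inl ?_, ?_, ?_⟩ <;> simp [parent, h', Arc, hub, rank, parentWeight, weightFun]
        · refine ⟨Or.inl ?_, ?_, ?_⟩
          · simp only [parent, h', Arc, if_false, true_and]; omega
          · simp only [parent, h', rank, if_false]; omega
          · simp [parent, h', weightFun, parentWeight]
      · by_cases h' : i.val = 0
        · have h0 : i = 0 := Fin.ext h'
          refine ⟨Or.inl ?_, ?_, ?_⟩ <;>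
            simp [parent, h0, Arc, hub, rank, parentWeight, weightFun]
        · refine ⟨Or.inl ?_, ?_, ?_⟩
          · simp only [parent, h', Arc, if_false]; omega
          · simp only [parent, h', rank, if_false]; omega
          · simp [parent, h', weightFun]
      · refine ⟨Or.inl ?_, ?_, ?_⟩
        · simp [parent, Arc, center]
        · have := Nat.mul_le_mul_right D.R j.2.le
          simp only [parent, rank, center]; omega
        · simp [parent, center, weightFun, parentWeight]
      · refine ⟨Or.inl ?_, ?_, ?_⟩ <;> simp [parent, Arc, rank, weightFun, parentWeight])
  refine ⟨_, p, h1, ?_⟩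
  have h3 : (∑ x, D.parentWeight x) =
      D.N * D.R * D.ε + 2 * D.N * ((D.K + 1) * D.α) + D.α + 2 * (D.N * D.d * D.ε) := by
    rw [← D.vertexEquiv.symm.sum_comp]
    simp only [Fintype.sum_sum_type, vertexEquiv, Equiv.coe_fn_symm_mk, parentWeight]
    rw [Fin.sum_univ_succ, Fin.sum_univ_succ]
    simp [Fin.succ_ne_zero, Finset.sum_const, Fintype.card_prod]
    ring
  rw [h3] at h2
  exact_mod_cast h2

/-- The lower bound on the competitive ratio given by a hub graph. -/
lemma Good.le_competitiveRatio (g : D.Good δ) {n : ℕ} (hn : (D.N * D.R + 1 + 2 * D.N * (D.K + 1)) +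
      (D.r + 1 + (D.N * D.d + D.N * D.d)) = n) {O : ℝ} (hO : 0 < O)
    (hle : 2 * (D.N * D.R * D.ε + 2 * D.N * ((D.K + 1) * D.α) + D.α + 2 * (D.N * D.d * D.ε)) ≤ O) :
    ENNReal.ofReal (D.N * D.d / O) ≤ competitiveRatio n δ := by
  obtain ⟨s, p, h1, h2⟩ := D.exists_closed_walk
  refine OnlineExploration.le_competitiveRatio (D.card_vertex.trans hn) hO
    ⟨s, p, h1, h2.trans hle⟩ (canCost_spine g 0 (Nat.succ_pos _) [spine 0] ?_)
  intro x
  simp only [List.mem_singleton, Nat.le_zero]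
  constructor
  · rintro rfl; exact ⟨0, rfl, rfl⟩
  · rintro ⟨i, hi, rfl⟩
    congr 1
    exact Fin.ext hi

end HubData

/-! ### Choice of the parameters -/

/-- The bound from hub graphs, in terms of the size `d` of the clusters. -/
lemma competitiveRatio_ge_of_cluster_size {δ : ℝ} (hδ : 0 < δ) {g d n : ℕ} (hg : δ ≤ 2 * (g + 1))
    (hd : δ + 3 ≤ d) (hn : 8 * d ^ 3 * (d ^ 2 + 1) ^ g ≤ n) :
    ENNReal.ofReal (d / (4 * (δ + 3))) ≤ competitiveRatio n δ := by
  have hd3 : (3 : ℝ) < d := by linarith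
  have hd0 : 0 < d := by
    have : (0 : ℝ) < d := by linarith
    exact_mod_cast this
  have hdR : (0 : ℝ) < d := by exact_mod_cast hd0
  obtain ⟨N, hN⟩ : ∃ N, N = d * (d ^ 2 + 1) ^ g := ⟨_, rfl⟩
  have hN0 : 0 < N := by rw [hN]; positivity
  have hNR : (1 : ℝ) ≤ N := by exact_mod_cast hN0
  have hn' : 8 * (N * d ^ 2) ≤ n := by
    refine le_trans (le_of_eq ?_) hn
    rw [hN]; ring
  obtain ⟨f, hf⟩ := exists_sparse_hypergraph hδ.le hg hd0 hN.ge
  obtain ⟨R, hR⟩ : ∃ R, R = ⌈(δ + 2) * d⌉₊ := ⟨_, rfl⟩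
  have hR1 : (δ + 2) * d ≤ R := hR ▸ Nat.le_ceil _
  have hR2 : (R : ℝ) < (δ + 2) * d + 1 := hR ▸ Nat.ceil_lt_add_one (by positivity)
  obtain ⟨K, hK⟩ : ∃ K, K + 1 = ⌈δ * d / 2⌉₊ :=
    ⟨⌈δ * d / 2⌉₊ - 1, Nat.sub_add_cancel (Nat.ceil_pos.2 (by positivity))⟩
  have hK1 : δ * d / 2 ≤ (K : ℝ) + 1 := by
    have := Nat.le_ceil (δ * d / 2)
    rw [← hK] at this
    exact_mod_cast this
  have hK2 : (K : ℝ) + 1 < δ * d / 2 + 1 := by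
    have := Nat.ceil_lt_add_one (a := δ * d / 2) (by positivity)
    rw [← hK] at this
    exact_mod_cast this
  have hRd : R ≤ d ^ 2 := by
    have : (R : ℝ) ≤ (d : ℝ) ^ 2 := by nlinarith
    exact_mod_cast this
  have hKd : K + 1 ≤ d ^ 2 := by
    have : (K : ℝ) + 1 ≤ (d : ℝ) ^ 2 := by nlinarith
    exact_mod_cast this
  have hNRd : N * R ≤ N * d ^ 2 := Nat.mul_le_mul_left _ hRd
  have hNKd : 2 * N * (K + 1) ≤ 2 * (N * d ^ 2) := by
    rw [mul_assoc]; exact Nat.mul_le_mul_left _ (Nat.mul_le_mul_left _ hKd)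
  have hNd : N * d ≤ N * d ^ 2 := Nat.mul_le_mul_left _ (Nat.le_self_pow two_ne_zero d)
  have hone : 1 ≤ N * d ^ 2 := Nat.one_le_iff_ne_zero.2 (by positivity)
  let ε : ℝ := 1 / d
  have hε0 : 0 < ε := by positivity
  have hε1 : ε < 1 := by rw [div_lt_one hdR]; linarith
  let α : ℝ := δ / (2 * (K + 1))
  have hα0 : 0 ≤ α := by positivity
  have hKα : 2 * (((K : ℝ) + 1) * α) = δ := by
    have : (K : ℝ) + 1 ≠ 0 := by positivity
    simp only [α]; field_simp
  have hαε : α ≤ ε := by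
    simp only [α, ε]
    rw [div_le_div_iff₀ (by positivity) hdR]
    linarith
  -- The increment of the heavy weights: positive, yet so small that even `N` increments keep `δ *
  -- (W j - 1) < ε`.
  let θ : ℝ := ε / ((δ + 1) * (N + 1))
  have hθ0 : 0 < θ := by positivity
  have hθN : θ * ((δ + 1) * (N + 1)) = ε := div_mul_cancel₀ _ (by positivity)
  have hθj : ∀ j : Fin N, θ * j.val * (δ + 1) < ε := by
    intro j
    rw [← hθN, mul_assoc, mul_comm (j.val : ℝ)]
    have : (j.val : ℝ) < N + 1 := by exact_mod_cast j.2.trans (Nat.lt_succ_self N)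
    gcongr
  -- The zero-weight part of the tip pads the vertex count to exactly `n` without changing the tour
  -- length.
  let D : HubData :=
    { N := N, d := d, K := K, R := R, r := n - (N * R + 1 + 2 * N * (K + 1) + 1 + (N * d + N * d)),
      f := f, α := ⟨α, hα0⟩, ε := ⟨ε, hε0.le⟩, W := fun j => ⟨1 + θ * j.val, by positivity⟩ }
  have hW0 : ∀ j : Fin N, 0 ≤ θ * j.val := fun j => by positivity
  have hD : D.Good δ :=
    { δ_pos := hδ
      N_pos := hN0
      d_pos := hd0
      R_pos := by
        have : (0 : ℝ) < R := lt_of_lt_of_le (by positivity) hR1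
        exact_mod_cast this
      arm_length := hKα
      α_le := hαε
      ε_mul_lt := by
        change (1 + δ) * (1 / d) < 1
        rw [mul_one_div, div_lt_one hdR]; linarith
      le_R_mul := by
        change δ + 2 ≤ R * (1 / d)
        rw [mul_one_div, le_div_iff₀ hdR]; exact hR1
      one_le_W := fun j => by
        change (1 : ℝ) ≤ 1 + θ * j.val
        linarith [hW0 j]
      W_le_two := fun j => by
        change 1 + θ * j.val ≤ (2 : ℝ)
        nlinarith [hW0 j, hθj j]
      W_strictMono := fun j j' hj => by
        change 1 + θ * (j.val : ℝ) < 1 + θ * j'.val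
        have : (j.val : ℝ) < j'.val := by exact_mod_cast hj
        gcongr
      W_close := fun j => by
        change δ * (1 + θ * j.val - 1) < ε
        nlinarith [hW0 j, hθj j]
      sparse := hf }
  have hRε : (R : ℝ) * ε ≤ δ + 3 := by
    simp only [ε]
    rw [mul_one_div, div_le_iff₀ hdR]; nlinarith
  have hdε : (d : ℝ) * ε = 1 := mul_one_div_cancel hdR.ne'
  have key := hD.le_competitiveRatio (n := n) (by
    change (N * R + 1 + 2 * N * (K + 1)) +
      (n - (N * R + 1 + 2 * N * (K + 1) + 1 + (N * d + N * d)) + 1 + (N * d + N * d)) = n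
    omega) (O := 4 * N * (δ + 3)) (by positivity) (by
    change 2 * ((N : ℝ) * R * ε + 2 * N * ((K + 1) * α) + α + 2 * (N * d * ε)) ≤ 4 * N * (δ + 3)
    have h1 : (N : ℝ) * R * ε ≤ N * (δ + 3) := by rw [mul_assoc]; gcongr
    have h2 : 2 * (N : ℝ) * ((K + 1) * α) = N * δ := by rw [← hKα]; ring
    have h3 : (N : ℝ) * d * ε = N := by rw [mul_assoc, hdε, mul_one]
    rw [h2, h3]
    nlinarith)
  convert key using 2
  change (d : ℝ) / (4 * (δ + 3)) = N * d / (4 * N * (δ + 3))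
  have : (N : ℝ) ≠ 0 := by positivity
  field_simp

/-- The bound from brooms. -/
lemma competitiveRatio_ge_of_le_real {δ t : ℝ} {n : ℕ} (h1 : 1 ≤ t) (hδ : t ≤ δ) (hn : 4 * t ≤ n) :
    ENNReal.ofReal (t / 8) ≤ competitiveRatio n δ := by
  have hle := Nat.floor_le (zero_le_one.trans h1)
  have hlt := Nat.lt_floor_add_one t
  have hpos : 0 < ⌊t⌋₊ := Nat.floor_pos.2 h1
  have hpos' : (1 : ℝ) ≤ ⌊t⌋₊ := by exact_mod_cast hpos
  refine le_trans (ENNReal.ofReal_le_ofReal ?_) (competitiveRatio_ge_of_le n ⌊t⌋₊ hpos ?_ ?_)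
  · linarith
  · have : (4 : ℝ) * ⌊t⌋₊ ≤ n := by linarith
    exact_mod_cast this
  · linarith

lemma tendsto_log_natCast : Tendsto (fun n : ℕ => Real.log n) atTop atTop :=
  Real.tendsto_log_atTop.comp tendsto_natCast_atTop_atTop

lemma eventually_mul_log_le (C : ℝ) : ∀ᶠ x : ℝ in atTop, C * Real.log x ≤ x := by
  have h := Real.isLittleO_log_id_atTop.bound (c := 1 / (|C| + 1)) (by positivity)
  filter_upwards [h, eventually_ge_atTop 1] with x hx h1
  have hlog := Real.log_nonneg h1
  simp only [id, Real.norm_eq_abs, abs_of_nonneg hlog, abs_of_nonneg (zero_le_one.trans h1)] at hx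
  rw [div_mul_eq_mul_div, one_mul, le_div_iff₀ (by positivity)] at hx
  have := le_abs_self C
  nlinarith

/-- For small `δ`, the competitive ratio is at least of the order `log n`. -/
lemma eventually_competitiveRatio_ge : ∀ᶠ n : ℕ in atTop, ∀ δ : ℝ, 0 < δ →
    δ ≤ 1 / 9 * (Real.log n / Real.log (Real.log n)) →
    ENNReal.ofReal (Real.log n / 4) ≤ competitiveRatio n δ := by
  have hloglog := Real.tendsto_log_atTop.comp tendsto_log_natCast
  -- With `ℓ = log n` and `x = log ℓ`, the instance has size at most `ℓ ^ (10 + 7 * g)` where `g < δ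
  -- / 2 + 1`. The exponent times `x` is below `17 * x + 7 / 2 * (δ * x)`, at most `(17 / 38 + 7 /
  -- 18) * ℓ < ℓ`.
  filter_upwards [tendsto_log_natCast.eventually_ge_atTop 8, hloglog.eventually_ge_atTop 1,
    tendsto_log_natCast.eventually (eventually_mul_log_le 38), eventually_gt_atTop 0]
    with n hℓ hx hxℓ hn0 δ hδ hle
  simp only [Function.comp_apply] at hx
  set ℓ := Real.log n with hℓdef
  set x := Real.log ℓ with hxdef
  have hx0 : 0 < x := by linarith
  have hℓ0 : 0 < ℓ := by linarith
  have hδx : δ * x ≤ ℓ / 9 := by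
    have := mul_le_mul_of_nonneg_right hle hx0.le
    have h2 : 1 / 9 * (ℓ / x) * x = ℓ / 9 := by field_simp
    linarith
  have hδℓ : δ ≤ ℓ / 9 := by nlinarith
  -- `δ + 3 ≤ ℓ`, so clusters of size `ℓ ^ 2` make `d / (δ + 3)` at least `ℓ`.
  set d := ⌈ℓ ^ 2⌉₊ with hd
  set g := ⌈δ / 2⌉₊ with hg
  have hd1 : ℓ ^ 2 ≤ d := Nat.le_ceil _
  have hd2 : (d : ℝ) < ℓ ^ 2 + 1 := Nat.ceil_lt_add_one (by positivity)
  have hg1 : δ / 2 ≤ g := Nat.le_ceil _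
  have hg2 : (g : ℝ) < δ / 2 + 1 := Nat.ceil_lt_add_one (by positivity)
  have hdℓ : (d : ℝ) ≤ ℓ ^ 3 := by nlinarith [sq_nonneg ℓ]
  have hsize : 8 * d ^ 3 * (d ^ 2 + 1) ^ g ≤ n := by
    have h1 : (8 : ℝ) * (d : ℝ) ^ 3 ≤ ℓ ^ 10 := by
      calc (8 : ℝ) * (d : ℝ) ^ 3 ≤ ℓ * (ℓ ^ 3) ^ 3 := by gcongr
        _ = ℓ ^ 10 := by ring
    have h2 : (d : ℝ) ^ 2 + 1 ≤ ℓ ^ 7 := by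
      have h3 : (d : ℝ) ^ 2 ≤ (ℓ ^ 3) ^ 2 := by gcongr
      have h4 : (1 : ℝ) ≤ ℓ ^ 6 := one_le_pow₀ (by linarith)
      calc (d : ℝ) ^ 2 + 1 ≤ 2 * ℓ ^ 6 := by nlinarith
        _ ≤ ℓ * ℓ ^ 6 := by gcongr; linarith
        _ = ℓ ^ 7 := by ring
    have h5 : (8 : ℝ) * (d : ℝ) ^ 3 * ((d : ℝ) ^ 2 + 1) ^ g ≤ n := by
      calc (8 : ℝ) * (d : ℝ) ^ 3 * ((d : ℝ) ^ 2 + 1) ^ g ≤ ℓ ^ 10 * (ℓ ^ 7) ^ g := by gcongr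
        _ = ℓ ^ (10 + 7 * g) := by rw [pow_add, pow_mul]
        _ = Real.exp ((10 + 7 * g : ℕ) * x) := by
          rw [Real.exp_nat_mul, hxdef, Real.exp_log hℓ0]
        _ ≤ Real.exp ℓ := by
          apply Real.exp_le_exp.2
          push_cast
          nlinarith
        _ = n := by rw [hℓdef, Real.exp_log (by exact_mod_cast hn0)]
    exact_mod_cast h5
  refine le_trans (ENNReal.ofReal_le_ofReal ?_)
    (competitiveRatio_ge_of_cluster_size (d := d) (g := g) hδ (by linarith) (by nlinarith) hsize)
  rw [div_le_div_iff₀ (by norm_num) (by positivity)]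
  nlinarith

end OnlineExploration

/-! ### Combination of the two families. -/

theorem theorem3 (δ : ℕ → ℝ) (hδ : ∀ n, 0 < δ n) :
    OnlineExploration.IsOmega (fun n => OnlineExploration.competitiveRatio n (δ n))
      (fun n => Real.log n / Real.log (Real.log n)) ∧
    (δ =o[atTop] (fun n : ℕ => Real.log n / Real.log (Real.log n)) →
      OnlineExploration.IsOmega (fun n => OnlineExploration.competitiveRatio n (δ n))
        (fun n => Real.log n)) ∧
    ((fun n : ℕ => Real.log n) =O[atTop] δ →
      OnlineExploration.IsOmega (fun n => OnlineExploration.competitiveRatio n (δ n))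
        (fun n => Real.log n)) := by
  have hℓ := OnlineExploration.tendsto_log_natCast
  have hloglog := Real.tendsto_log_atTop.comp hℓ
  have hlogle := tendsto_natCast_atTop_atTop.eventually
    (OnlineExploration.eventually_mul_log_le 4)
  refine ⟨⟨1 / 72, by norm_num, ?_⟩, fun hlittle => ⟨1 / 4, by norm_num, ?_⟩, fun hbig => ?_⟩
  · filter_upwards [OnlineExploration.eventually_competitiveRatio_ge,
      hℓ.eventually_ge_atTop 1, hloglog.eventually_ge_atTop 1,
      hℓ.eventually (OnlineExploration.eventually_mul_log_le 9), hlogle] with n h1 h2 h3 h4 h5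
    simp only [Function.comp_apply] at h3
    have hx0 : 0 < Real.log (Real.log n) := by linarith
    have hdiv : Real.log n / Real.log (Real.log n) ≤ Real.log n :=
      div_le_self (by linarith) h3
    have hdiv9 : 9 ≤ Real.log n / Real.log (Real.log n) := by
      rw [le_div_iff₀ hx0]; exact h4
    -- `δ` need not be regular, so the family is chosen separately for each `n`.
    rcases le_or_gt (δ n) (1 / 9 * (Real.log n / Real.log (Real.log n))) with hle | hgt
    · exact (ENNReal.ofReal_le_ofReal (by linarith)).trans (h1 _ (hδ n) hle)
    · refine (ENNReal.ofReal_le_ofReal (le_of_eq ?_)).trans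
        (OnlineExploration.competitiveRatio_ge_of_le_real
          (t := 1 / 9 * (Real.log n / Real.log (Real.log n))) ?_ hgt.le ?_)
      · ring
      · linarith
      · linarith
  · filter_upwards [OnlineExploration.eventually_competitiveRatio_ge,
      hlittle.bound (c := 1 / 9) (by norm_num), hℓ.eventually_ge_atTop 1,
      hloglog.eventually_ge_atTop 1] with n h1 h2 h3 h4
    simp only [Function.comp_apply] at h4
    rw [Real.norm_eq_abs, Real.norm_eq_abs, abs_of_pos (hδ n),
      abs_of_nonneg (div_nonneg (by linarith) (by linarith))] at h2
    have := h1 _ (hδ n) h2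
    rwa [div_eq_inv_mul, ← one_div] at this
  · obtain ⟨C, hC⟩ := hbig.bound
    refine ⟨1 / (8 * max C 1), by positivity, ?_⟩
    filter_upwards [hC, hℓ.eventually_ge_atTop (max C 1), hlogle] with n h1 h2 h3
    have hC1 : 1 ≤ max C 1 := le_max_right _ _
    have hC0 : 0 < max C 1 := by linarith
    have hn0 : 0 ≤ Real.log n := by linarith
    rw [Real.norm_eq_abs, Real.norm_eq_abs, abs_of_pos (hδ n), abs_of_nonneg hn0] at h1
    refine (ENNReal.ofReal_le_ofReal (le_of_eq ?_)).trans
      (OnlineExploration.competitiveRatio_ge_of_le_real (t := Real.log n / max C 1) ?_ ?_ ?_)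
    · field_simp
    · rwa [le_div_iff₀ hC0, one_mul]
    · rw [div_le_iff₀ hC0, mul_comm]
      exact h1.trans (mul_le_mul_of_nonneg_right (le_max_left _ _) (hδ n).le)
    · have := div_le_self hn0 hC1
      linarith
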